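/- An instance of the restricted common supersequence problem $\mathrm{RCSseq}[2]$ consists of a set $S$ of distinct strings of length at most $2$ and a finite multiset $t$ of characters, such that every string in $S$ is a substring of at least one ordering of $t$; the goal is to find an ordering of $t$ that has as many strings of $S$ as possible as subsequences. Let $\Delta$ be the maximum, over all characters, of the total number of occurrences of the character in the strings of $S$. Consider the following algorithm. (1) Let $P'$ be the set of characters that occur exactly once in $t$, let $P$ be the set of characters that occur at least twice in $t$, and let $Q$ be the multiset that contains every $\sigma\in P$ with multiplicity $r-2$, where $r$ is the multiplicity of $\sigma$ in $t$. Let $G$ be the directed graph with vertex set $P'$ and with an arc $(a,b)$ for all $a,b\in P'$ with $ab\in S$. (2) Apply to $G$ a polynomial-time algorithm $\mathcal A$ for the maximum acyclic subgraph problem which, for some constant $c\in(0,1]$, returns on every finite loopless directed graph of maximum (total) degree $D$ an acyclic set of arcs with at least $\frac12\left(1+c/\sqrt{D}\right)$ times the maximum possible number of arcs. (3) Let $F'$ be a topological order of $P'$ with respect to the arcs returned, and let $F$ and $F''$ be arbitrary orderings of $P$ and $Q$. (4) Output $F\cdot F'\cdot F\cdot F''$. Then this is a $\frac12\left(1+\Omega(1/\sqrt{\Delta})\right)$-approximation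 algorithm for $\mathrm{RCSseq}[2]$. Precisely: (i) For every such $\mathcal A$, with constant $c$, the algorithm can be carried out in a number of steps polynomial in the size of $(S,t)$ (with a polynomial that depends only on the one that bounds the running time of $\mathcal A$), and for every instance and all choices of $F$, $F'$, $F''$ the output is an ordering of $t$ that has at least $\frac12\left(1+c/\sqrt{\Delta}\right)$ times as many strings of $S$ as subsequences as any other ordering of $t$. (ii) Such an algorithm $\mathcal A$ exists: an explicit one (a derandomization by conditional expectations of the algorithm that removes the vertices in random order, each vertex keeping the larger of its two sets of remaining entering and leaving arcs) has the required properties with an absolute constant $c\in(0,1]$. Hence, with it, the algorithm runs in polynomial time and has approximation ratio at least $\frac12\left(1+c/\sqrt{\Delta}\right)$ unconditionally. (For $\Delta=0$ or $D=0$, the term $c/\sqrt{0}$ is read as $0$.) -/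

import Mathlib

namespace RCS

/-! ### Computations with a step count -/

/-- A value together with the number of elementary steps spent on computing it. -/
structure Timed (β : Type) where
  val : β
  steps : ℕ

instance : Monad Timed where
  pure b := ⟨b, 0⟩
  bind x f := ⟨(f x.val).val, x.steps + (f x.val).steps⟩

/-- Spend `k` elementary steps. The elementary steps are: one level of recursion of a loop (which
includes taking apart or building one list cell), one comparison of two characters, arcs or
numbers, one arithmetic operation. All numbers that occur in the programs below are bounded by a
polynomial in the size of the input. -/
def charge (k : ℕ) : Timed Unit := ⟨(), k⟩

section Loops

variable {α β : Type}

/-- Comparison of two characters (or of two pairs of characters). -/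
def eqT [DecidableEq α] (a b : α) : Timed Bool := ⟨decide (a = b), 1⟩

/-- The elements of a list that pass a test. -/
def filterT (p : α → Timed Bool) : List α → Timed (List α)
  | [] => do
    charge 1
    pure []
  | x :: xs => do
    charge 1
    let b ← p x
    let ys ← filterT p xs
    if b then pure (x :: ys) else pure ys

/-- Does some element of a list pass a test? -/
def anyT (p : α → Timed Bool) : List α → Timed Bool
  | [] => do
    charge 1
    pure false
  | x :: xs => do
    charge 1
    let b ← p x
    if b then pure true else anyT p xs

/-- Membership in a list. -/
def memT [DecidableEq α] (a : α) (l : List α) : Timed Bool :=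
  anyT (fun x => eqT a x) l

/-- The length of a list. -/
def lengthT : List α → Timed ℕ
  | [] => do
    charge 1
    pure 0
  | _ :: xs => do
    charge 2
    let k ← lengthT xs
    pure (k + 1)

/-- The number of elements of a list that pass a test. -/
def countT (p : α → Timed Bool) (l : List α) : Timed ℕ := do
  let l' ← filterT p l
  lengthT l'

/-- Concatenation of two lists. -/
def appendT : List α → List α → Timed (List α)
  | [], ys => do
    charge 1
    pure ys
  | x :: xs, ys => do
    charge 1
    let zs ← appendT xs ys
    pure (x :: zs)

/-- Deletion of duplicates. -/
def dedupT [DecidableEq α] : List α → Timed (List α)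
  | [] => do
    charge 1
    pure []
  | x :: xs => do
    charge 1
    let ys ← dedupT xs
    let b ← memT x ys
    if b then pure ys else pure (x :: ys)

/-- `k` copies of `a`. -/
def replicateT (a : α) : ℕ → Timed (List α)
  | 0 => do
    charge 1
    pure []
  | k + 1 => do
    charge 2
    let l ← replicateT a k
    pure (a :: l)

/-- The concatenation of the lists that `f` produces from the elements of a list. -/
def flatMapT (f : α → Timed (List β)) : List α → Timed (List β)
  | [] => do
    charge 1
    pure []
  | x :: xs => do
    charge 1
    let ys ← f x
    let zs ← flatMapT f xs
    appendT ys zs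

/-- The largest of the numbers that `f` assigns to the elements of a list. -/
def maxT (f : α → Timed ℕ) : List α → Timed ℕ
  | [] => do
    charge 1
    pure 0
  | x :: xs => do
    charge 2
    let k ← f x
    let m ← maxT f xs
    pure (max k m)

/-- The sum of the numbers that `f` assigns to the elements of a list. -/
def sumT (f : α → Timed ℤ) : List α → Timed ℤ
  | [] => do
    charge 1
    pure 0
  | x :: xs => do
    charge 2
    let k ← f x
    let m ← sumT f xs
    pure (k + m)

/-- An element of a list at which `f` is largest, with the value of `f` there. -/
def argmaxT (f : α → Timed ℤ) : List α → Timed (Option (α × ℤ))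
  | [] => do
    charge 1
    pure none
  | x :: xs => do
    charge 2
    let k ← f x
    let r ← argmaxT f xs
    match r with
    | none => pure (some (x, k))
    | some (y, m) => if m ≤ k then pure (some (x, k)) else pure (some (y, m))

/-- The first element of a list that passes a test. -/
def findT (p : α → Timed Bool) : List α → Timed (Option α)
  | [] => do
    charge 1
    pure none
  | x :: xs => do
    charge 1
    let b ← p x
    if b then pure (some x) else findT p xs

/-- The least `r ≤ k` with `d ≤ r * r`, or `k` if there is none. -/
def rootT (d : ℕ) : ℕ → Timed ℕ
  | 0 => do
    charge 1
    pure 0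
  | k + 1 => do
    charge 4
    let r ← rootT d k
    if d ≤ r * r then pure r else pure (k + 1)

/-- A list without the entries equal to `a`. -/
def removeT [DecidableEq α] (a : α) (l : List α) : Timed (List α) :=
  filterT (fun x => do
    let b ← eqT a x
    pure (!b)) l

/-- Does `a` come before `b` in a list? -/
def beforeT [DecidableEq α] (a b : α) : List α → Timed Bool
  | [] => do
    charge 1
    pure false
  | x :: xs => do
    charge 1
    let h ← eqT x a
    if h then pure true else do
      let h' ← eqT x b
      if h' then pure false else beforeT a b xs

end Loops

/-! ### The maximum acyclic subgraph problem -/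

section Digraphs

variable {α : Type}

/-- `V` lists the vertices and `E` the arcs of a finite directed graph without loops. -/
def IsDigraph (V : List α) (E : List (α × α)) : Prop :=
  V.Nodup ∧ E.Nodup ∧ ∀ e ∈ E, e.1 ∈ V ∧ e.2 ∈ V ∧ e.1 ≠ e.2

/-- There is no directed cycle of arcs from `A`. -/
def Acyclic (A : List (α × α)) : Prop :=
  ∀ v, ¬ Relation.TransGen (fun a b => (a, b) ∈ A) v v

/-- `A` lists, without repetition, a set of arcs from `E` that contains no directed cycle. -/
def IsAcyclicSubgraph (E A : List (α × α)) : Prop :=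
  A.Nodup ∧ A ⊆ E ∧ Acyclic A

/-- The degree of a vertex: the number of arcs that enter or leave it. -/
def degree [DecidableEq α] (E : List (α × α)) (v : α) : ℕ :=
  E.countP (fun e => e.1 = v ∨ e.2 = v)

/-- The maximum degree of a vertex. -/
def maxDegree [DecidableEq α] (V : List α) (E : List (α × α)) : ℕ :=
  V.toFinset.sup (degree E)

/-- The list `F` is a topological order of the directed graph with vertices `V` and arcs `A`. -/
def IsTopologicalOrder [DecidableEq α] (V : List α) (A : List (α × α)) (F : List α) : Prop :=
  F.Perm V ∧ ∀ e ∈ A, F.idxOf e.1 < F.idxOf e.2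

/-- A procedure that is given the vertices and the arcs of a graph and returns a list of arcs. -/
abbrev Subroutine (α : Type) : Type := List α → List (α × α) → Timed (List (α × α))

/-- On every loopless directed graph the procedure returns an acyclic subgraph that has at least
`(1 + c / √Δ) / 2` times as many arcs as any other, where `Δ` is the maximum degree, after at most
`p (|V| + |E|)` steps. -/
def IsMASApprox [DecidableEq α] (A : Subroutine α) (c : ℝ) (p : Polynomial ℕ) : Prop :=
  ∀ (V : List α) (E : List (α × α)), IsDigraph V E →
    IsAcyclicSubgraph E (A V E).val ∧
    (∀ B, IsAcyclicSubgraph E B →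
      (1 + c / √(maxDegree V E : ℝ)) / 2 * (B.length : ℝ) ≤ ((A V E).val.length : ℝ)) ∧
    (A V E).steps ≤ p.eval (V.length + E.length)

/-- The number of arcs that lead from a vertex in `R` to `v`. -/
def inDegT [DecidableEq α] (E : List (α × α)) (R : List α) (v : α) : Timed ℕ :=
  countT (fun e => do
    let b ← eqT e.2 v
    if b then memT e.1 R else pure false) E

/-- The number of arcs that lead from `v` to a vertex in `R`. -/
def outDegT [DecidableEq α] (E : List (α × α)) (R : List α) (v : α) : Timed ℕ :=
  countT (fun e => do
    let b ← eqT e.1 v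
    if b then memT e.2 R else pure false) E

/-- For a vertex with `a` entering and `b` leaving arcs, none of them on a directed 2-cycle: a lower
estimate of `60 * L ^ 3` times the expected difference (in absolute value) of its numbers of
entering and leaving arcs at the moment when it is removed, if the vertices are removed in random
order. -/
def potential (L a b : ℕ) : ℤ :=
  let D : ℤ := (a : ℤ) - (b : ℤ)
  let d : ℤ := (a : ℤ) + (b : ℤ)
  max (30 * (L : ℤ) ^ 3 * |D|)
    (15 * (L : ℤ) ^ 2 * (2 * D ^ 2 + d) - 12 * D ^ 4 - 18 * D ^ 2 * d + 4 * D ^ 2 - 6 * d ^ 2 + 2 * d)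

/-- The potential of the vertex `v` in the subgraph on `R`. -/
def potentialT [DecidableEq α] (E : List (α × α)) (L : ℕ) (R : List α) (v : α) :
    Timed ℤ := do
  let a ← inDegT E R v
  let b ← outDegT E R v
  charge 40
  pure (potential L a b)

/-- What is gained by removing `x` from the subgraph on `R`, plus the potential of what remains. -/
def scoreT [DecidableEq α] (E : List (α × α)) (L : ℕ) (R : List α) (x : α) :
    Timed ℤ := do
  let a ← inDegT E R x
  let b ← outDegT E R x
  let R' ← removeT x R
  let s ← sumT (potentialT E L R') R'
  charge 10
  pure (60 * (L : ℤ) ^ 3 * |(a : ℤ) - (b : ℤ)| + s)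

/-- Orders the vertices in `R`: remove a vertex of largest score, order the others, and put the
removed vertex first or last, whichever agrees with more of its arcs. The number is a bound on the
depth of the recursion. -/
def peelT [DecidableEq α] (E : List (α × α)) (L : ℕ) : ℕ → List α → Timed (List α)
  | 0, _ => do
    charge 1
    pure []
  | k + 1, R => do
    charge 3
    let m ← argmaxT (scoreT E L R) R
    match m with
    | none => pure []
    | some (x, _) => do
      let a ← inDegT E R x
      let b ← outDegT E R x
      let R' ← removeT x R
      let o ← peelT E L k R'
      if a ≤ b then pure (x :: o) else appendT o [x]

/-- An approximation algorithm for the maximum acyclic subgraph problem. The vertices are removed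
one by one in an order that derandomizes a random one by conditional expectations, each of them
keeping the larger of its two sets of remaining arcs (the entering and the leaving ones). Arcs whose
reverse is an arc, too, have no influence on the order. -/
def approxMAS [DecidableEq α] : Subroutine α := fun V E => do
  let E₁ ← filterT (fun e => do
    let b ← memT (e.2, e.1) E
    pure (!b)) E
  let Δ ← maxT (fun v => countT (fun e => do
    let b ← eqT e.1 v
    if b then pure b else eqT e.2 v) E) V
  let L ← rootT Δ Δ
  let n ← lengthT V
  let o ← peelT E₁ L n V
  filterT (fun e => beforeT e.1 e.2 o) E

end Digraphs

/-! ### The restricted common supersequence problem -/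

section Supersequence

variable {α : Type}

/-- An instance of the restricted common superstring and supersequence problems, with strings of
length at most `l`: a list `S` of distinct strings and a multiset of characters, given by a list
`t`, such that every string in `S` is a substring of some ordering of the multiset. -/
def IsInstance (l : ℕ) (S : List (List α)) (t : List α) : Prop :=
  S.Nodup ∧ ∀ s ∈ S, s.length ≤ l ∧ ∃ w : List α, w.Perm t ∧ s <:+: w

/-- The number of strings in `S` that are subsequences of `w`. -/
def satisfied [DecidableEq α] (S : List (List α)) (w : List α) : ℕ :=
  S.countP (fun s => s.Sublist w)

/-- The number of occurrences in `S` of the most frequent character. -/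
def maxOccurrences [DecidableEq α] (S : List (List α)) : ℕ :=
  S.flatten.toFinset.sup (fun a => S.flatten.count a)

/-- The size of an instance. -/
def size (S : List (List α)) (t : List α) : ℕ :=
  S.length + S.flatten.length + t.length

/-- The possible outputs `F · F' · F · F''` of the algorithm with a given procedure `mas` for the
acyclic subgraph, for all choices that it leaves open: the order in which vertices and arcs are
listed, the orderings `F` and `F''`, and the topological order `F'`. -/
def IsOutput [DecidableEq α] (mas : List α → List (α × α) → List (α × α))
    (S : List (List α)) (t w : List α) : Prop :=
  ∃ (V : List α) (E : List (α × α)) (F F' F'' : List α),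
    (V.Nodup ∧ ∀ a, a ∈ V ↔ t.count a = 1) ∧
    (E.Nodup ∧ ∀ a b, (a, b) ∈ E ↔ a ∈ V ∧ b ∈ V ∧ [a, b] ∈ S) ∧
    (F.Nodup ∧ ∀ a, a ∈ F ↔ 2 ≤ t.count a) ∧
    IsTopologicalOrder V (mas V E) F' ∧
    (∀ a, F''.count a = t.count a - 2) ∧
    w = F ++ F' ++ F ++ F''

/-- The arcs `(a, b)` with `a` and `b` in `V` for which `ab` is one of the given strings. -/
def arcsT [DecidableEq α] (V : List α) (S : List (List α)) : Timed (List (α × α)) :=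
  flatMapT (fun s => do
    charge 1
    match s with
    | [a, b] => do
      let h ← memT a V
      let h' ← memT b V
      if h && h' then pure [(a, b)] else pure []
    | _ => pure []) S

/-- A topological order of the subgraph of an acyclic graph on `R`: list a vertex without entering
arcs, then order the others. The number is a bound on the depth of the recursion. -/
def topologicalT [DecidableEq α] (A : List (α × α)) : ℕ → List α → Timed (List α)
  | 0, _ => do
    charge 1
    pure []
  | k + 1, R => do
    charge 2
    let m ← findT (fun v => do
      let d ← inDegT A R v
      charge 1
      pure (decide (d = 0))) R
    match m with
    | none => pure []
    | some x => do
      let R' ← removeT x R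
      let o ← topologicalT A k R'
      pure (x :: o)

/-- The approximation algorithm for supersequences, with a procedure `A` for the acyclic subgraph.
The characters that occur once in `t` are the vertices. -/
def algorithm [DecidableEq α] (A : Subroutine α) (S : List (List α)) (t : List α) :
    Timed (List α) := do
  let V ← filterT (fun a => do
    let k ← countT (fun x => eqT a x) t
    charge 1
    pure (decide (k = 1))) t
  let C ← dedupT t
  let F ← filterT (fun a => do
    let k ← countT (fun x => eqT a x) t
    charge 1
    pure (decide (2 ≤ k))) C
  let F'' ← flatMapT (fun a => do
    let k ← countT (fun x => eqT a x) t
    charge 1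
    replicateT a (k - 2)) F
  let E ← arcsT V S
  let E' ← A V E
  let n ← lengthT V
  let F' ← topologicalT E' n V
  let w₁ ← appendT F F''
  let w₂ ← appendT F' w₁
  appendT F w₂

/-- The algorithm with the procedure `A` approximates the supersequence problem for strings of
length at most two within the factor `(1 + c / √Δ) / 2`, where `Δ` is the maximum number of
occurrences of a character in `S`, in at most `q (size)` steps. The approximation holds for all
choices that the algorithm leaves open. -/
def Guarantee [DecidableEq α] (A : Subroutine α) (c : ℝ) (q : Polynomial ℕ) : Prop :=
  ∀ (S : List (List α)) (t : List α), IsInstance 2 S t →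
    (algorithm A S t).steps ≤ q.eval (size S t) ∧
    IsOutput (fun V E => (A V E).val) S t (algorithm A S t).val ∧
    ∀ w, IsOutput (fun V E => (A V E).val) S t w →
      w.Perm t ∧
      ∀ w' : List α, w'.Perm t →
        (1 + c / √(maxOccurrences S : ℝ)) / 2 * (satisfied S w' : ℝ) ≤ (satisfied S w : ℝ)

end Supersequence

end RCS

/-! Supersequences. In `F ++ F' ++ F ++ F''` every string of `S` is a subsequence unless both of its
characters occur just once in `t`. Those exceptional strings are the arcs of the graph, and each arc
that the topological order respects is satisfied as well (`output_spec`). Conversely, the arcs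
satisfied by any ordering of `t` form an acyclic set, because their ends occur only once in it.
Degrees in the graph are at most Δ, so the ratio for arcs carries over to all strings
(`approximation_of_isOutput`).

Acyclic subgraphs. A vertex removed with `a` entering and `b` leaving remaining arcs keeps max(a, b)
= (a + b)/2 + |a - b|/2 of them. An order therefore obtains half of the arcs plus half of the sum of
the imbalances |a - b|. If the removal order is random, a vertex of degree d ≤ L² has expected
imbalance of order at least d/L: for an initial imbalance of at least L this is Jensen's inequality,
otherwise it follows from the second and fourth moments and |y| ≥ (3L²y² - 2y⁴)/(2L³). The larger of
the two bounds, times 60L³, is `potential`.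

By `potential_le_average`, the average score of a removal is at least the present total potential.
Hence a removal of largest score loses nothing, which is the invariant of `peelT_spec`. Summing
`le_potential` over the vertices, with L of order √Δ, gives the gain over one half.

Of the arcs on directed 2-cycles every order obtains exactly half, and no acyclic set contains more.
They can be ignored when the order is chosen (`two_mul_forward_eq`, `two_mul_length_le`). -/

namespace RCS

/-! ### Values and step counts of the list programs -/

section Loops

variable {α β γ : Type}

@[simp] theorem val_pure (b : β) : (pure b : Timed β).val = b := rfl

@[simp] theorem steps_pure (b : β) : (pure b : Timed β).steps = 0 := rfl

@[simp] theorem val_bind (x : Timed β) (f : β → Timed γ) : (x >>= f).val = (f x.val).val := rfl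

@[simp] theorem steps_bind (x : Timed β) (f : β → Timed γ) :
    (x >>= f).steps = x.steps + (f x.val).steps := rfl

@[simp] theorem steps_charge (k : ℕ) : (charge k).steps = k := rfl

@[simp] theorem val_ite (p : Prop) [Decidable p] (x y : Timed β) :
    (if p then x else y).val = if p then x.val else y.val := apply_ite _ _ _ _

@[simp] theorem steps_ite (p : Prop) [Decidable p] (x y : Timed β) :
    (if p then x else y).steps = if p then x.steps else y.steps := apply_ite _ _ _ _

@[simp] theorem val_eqT [DecidableEq α] (a b : α) : (eqT a b).val = decide (a = b) := rfl

@[simp] theorem steps_eqT [DecidableEq α] (a b : α) : (eqT a b).steps = 1 := rfl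

@[simp] theorem val_filterT (p : α → Timed Bool) (l : List α) :
    (filterT p l).val = l.filter (fun x => (p x).val) := by
  induction l with
  | nil => rfl
  | cons x xs ih => simp [filterT, ih, List.filter_cons]

theorem steps_filterT_le {p : α → Timed Bool} {l : List α} {k : ℕ}
    (h : ∀ x ∈ l, (p x).steps ≤ k) : (filterT p l).steps ≤ l.length * (k + 1) + 1 := by
  induction l with
  | nil => simp [filterT]
  | cons x xs ih =>
    have h₁ := h x (by simp)
    have h₂ := ih fun y hy => h y (by simp [hy])
    simp only [filterT, steps_bind, steps_charge, steps_ite, steps_pure, List.length_cons, ite_self]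
    linarith

@[simp] theorem val_anyT (p : α → Timed Bool) (l : List α) :
    (anyT p l).val = l.any (fun x => (p x).val) := by
  induction l with
  | nil => rfl
  | cons x xs ih =>
    simp only [anyT, val_bind, val_ite, val_pure, ih, List.any_cons]
    cases (p x).val <;> simp

theorem steps_anyT_le {p : α → Timed Bool} {l : List α} {k : ℕ}
    (h : ∀ x ∈ l, (p x).steps ≤ k) : (anyT p l).steps ≤ l.length * (k + 1) + 1 := by
  induction l with
  | nil => simp [anyT]
  | cons x xs ih =>
    have h₁ := h x (by simp)
    have h₂ := ih fun y hy => h y (by simp [hy])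
    simp only [anyT, steps_bind, steps_charge, steps_ite, steps_pure, List.length_cons]
    split_ifs <;> linarith

@[simp] theorem val_memT [DecidableEq α] (a : α) (l : List α) :
    (memT a l).val = decide (a ∈ l) := by
  rw [Bool.eq_iff_iff]
  simp [memT]

theorem steps_memT_le [DecidableEq α] (a : α) (l : List α) :
    (memT a l).steps ≤ 2 * l.length + 1 := by
  have := steps_anyT_le (p := fun x => eqT a x) (l := l) (k := 1) (by simp)
  rw [memT]
  linarith

@[simp] theorem val_lengthT (l : List α) : (lengthT l).val = l.length := by
  induction l with
  | nil => rfl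
  | cons x xs ih => simp [lengthT, ih]

@[simp] theorem steps_lengthT (l : List α) : (lengthT l).steps = 2 * l.length + 1 := by
  induction l with
  | nil => rfl
  | cons x xs ih => simp [lengthT, ih]; ring

@[simp] theorem val_countT (p : α → Timed Bool) (l : List α) :
    (countT p l).val = l.countP (fun x => (p x).val) := by
  simp [countT, List.countP_eq_length_filter]

theorem steps_countT_le {p : α → Timed Bool} {l : List α} {k : ℕ}
    (h : ∀ x ∈ l, (p x).steps ≤ k) : (countT p l).steps ≤ l.length * (k + 3) + 2 := by
  have h₁ := steps_filterT_le h
  have h₂ := List.length_filter_le (fun x => (p x).val) l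
  simp only [countT, steps_bind, steps_lengthT, val_filterT]
  linarith

@[simp] theorem val_appendT (l l' : List α) : (appendT l l').val = l ++ l' := by
  induction l with
  | nil => rfl
  | cons x xs ih => simp [appendT, ih]

@[simp] theorem steps_appendT (l l' : List α) : (appendT l l').steps = l.length + 1 := by
  induction l with
  | nil => rfl
  | cons x xs ih => simp [appendT, ih]; ring

@[simp] theorem val_dedupT [DecidableEq α] (l : List α) : (dedupT l).val = l.dedup := by
  induction l with
  | nil => rfl
  | cons x xs ih =>
    by_cases h : x ∈ xs <;> simp [dedupT, ih, h]

theorem steps_dedupT_le [DecidableEq α] (l : List α) :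
    (dedupT l).steps ≤ l.length * (2 * l.length + 2) + 1 := by
  induction l with
  | nil => simp [dedupT]
  | cons x xs ih =>
    have h₁ := steps_memT_le x xs.dedup
    have h₂ := (List.dedup_sublist xs).length_le
    simp only [dedupT, steps_bind, steps_charge, steps_ite, steps_pure, List.length_cons, ite_self,
      val_dedupT]
    nlinarith

@[simp] theorem val_replicateT (a : α) (k : ℕ) : (replicateT a k).val = List.replicate k a := by
  induction k with
  | zero => rfl
  | succ k ih => simp [replicateT, ih, List.replicate_succ]

@[simp] theorem steps_replicateT (a : α) (k : ℕ) : (replicateT a k).steps = 2 * k + 1 := by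
  induction k with
  | zero => rfl
  | succ k ih => simp [replicateT, ih]; ring

@[simp] theorem val_flatMapT (f : α → Timed (List β)) (l : List α) :
    (flatMapT f l).val = l.flatMap (fun x => (f x).val) := by
  induction l with
  | nil => rfl
  | cons x xs ih => simp [flatMapT, ih]

theorem steps_flatMapT_le {f : α → Timed (List β)} {l : List α} {k m : ℕ}
    (h : ∀ x ∈ l, (f x).steps ≤ k) (h' : ∀ x ∈ l, (f x).val.length ≤ m) :
    (flatMapT f l).steps ≤ l.length * (k + m + 2) + 1 := by
  induction l with
  | nil => simp [flatMapT]
  | cons x xs ih =>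
    have h₁ := h x (by simp)
    have h₂ := h' x (by simp)
    have h₃ := ih (fun y hy => h y (by simp [hy])) (fun y hy => h' y (by simp [hy]))
    simp only [flatMapT, steps_bind, steps_charge, steps_appendT, List.length_cons]
    linarith

@[simp] theorem val_maxT [DecidableEq α] (f : α → Timed ℕ) (l : List α) :
    (maxT f l).val = l.toFinset.sup (fun x => (f x).val) := by
  induction l with
  | nil => rfl
  | cons x xs ih => simp [maxT, ih]

theorem steps_maxT_le {f : α → Timed ℕ} {l : List α} {k : ℕ}
    (h : ∀ x ∈ l, (f x).steps ≤ k) : (maxT f l).steps ≤ l.length * (k + 2) + 1 := by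
  induction l with
  | nil => simp [maxT]
  | cons x xs ih =>
    have h₁ := h x (by simp)
    have h₂ := ih fun y hy => h y (by simp [hy])
    simp only [maxT, steps_bind, steps_charge, steps_pure, List.length_cons]
    linarith

@[simp] theorem val_sumT (f : α → Timed ℤ) (l : List α) :
    (sumT f l).val = (l.map (fun x => (f x).val)).sum := by
  induction l with
  | nil => rfl
  | cons x xs ih => simp [sumT, ih]

theorem steps_sumT_le {f : α → Timed ℤ} {l : List α} {k : ℕ}
    (h : ∀ x ∈ l, (f x).steps ≤ k) : (sumT f l).steps ≤ l.length * (k + 2) + 1 := by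
  induction l with
  | nil => simp [sumT]
  | cons x xs ih =>
    have h₁ := h x (by simp)
    have h₂ := ih fun y hy => h y (by simp [hy])
    simp only [sumT, steps_bind, steps_charge, steps_pure, List.length_cons]
    linarith

theorem argmaxT_eq_none {f : α → Timed ℤ} {l : List α} (h : (argmaxT f l).val = none) :
    l = [] := by
  cases l with
  | nil => rfl
  | cons x xs =>
    simp only [argmaxT, val_bind] at h
    split at h
    · simp at h
    · split_ifs at h

theorem argmaxT_eq_some {f : α → Timed ℤ} {l : List α} {x : α} {k : ℤ}
    (h : (argmaxT f l).val = some (x, k)) :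
    x ∈ l ∧ (f x).val = k ∧ ∀ y ∈ l, (f y).val ≤ k := by
  induction l generalizing x k with
  | nil => simp [argmaxT] at h
  | cons z zs ih =>
    simp only [argmaxT, val_bind] at h
    split at h
    · rename_i hn
      obtain rfl := argmaxT_eq_none hn
      simp only [val_pure, Option.some.injEq, Prod.mk.injEq] at h
      obtain ⟨rfl, rfl⟩ := h
      simp
    · rename_i y m hs
      obtain ⟨h₁, h₂, h₃⟩ := ih hs
      split_ifs at h with hm <;> simp only [val_pure, Option.some.injEq, Prod.mk.injEq] at h <;>
        obtain ⟨rfl, rfl⟩ := h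
      · refine ⟨by simp, rfl, ?_⟩
        rintro w hw
        rcases List.mem_cons.1 hw with rfl | hw
        · exact le_rfl
        · exact (h₃ w hw).trans hm
      · refine ⟨by simp [h₁], h₂, ?_⟩
        rintro w hw
        rcases List.mem_cons.1 hw with rfl | hw
        · exact (not_le.1 hm).le
        · exact h₃ w hw

theorem steps_argmaxT_le {f : α → Timed ℤ} {l : List α} {k : ℕ}
    (h : ∀ x ∈ l, (f x).steps ≤ k) : (argmaxT f l).steps ≤ l.length * (k + 2) + 1 := by
  induction l with
  | nil => simp [argmaxT]
  | cons x xs ih =>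
    have h₁ := h x (by simp)
    have h₂ := ih fun y hy => h y (by simp [hy])
    simp only [argmaxT, steps_bind, steps_charge, List.length_cons]
    split <;> [skip; split_ifs] <;> simp only [steps_pure] <;> linarith

@[simp] theorem val_findT (p : α → Timed Bool) (l : List α) :
    (findT p l).val = l.find? (fun x => (p x).val) := by
  induction l with
  | nil => rfl
  | cons x xs ih =>
    simp only [findT, val_bind, val_ite, val_pure, ih, List.find?_cons]
    cases (p x).val <;> simp

theorem steps_findT_le {p : α → Timed Bool} {l : List α} {k : ℕ}
    (h : ∀ x ∈ l, (p x).steps ≤ k) : (findT p l).steps ≤ l.length * (k + 1) + 1 := by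
  induction l with
  | nil => simp [findT]
  | cons x xs ih =>
    have h₁ := h x (by simp)
    have h₂ := ih fun y hy => h y (by simp [hy])
    simp only [findT, steps_bind, steps_charge, steps_ite, steps_pure, List.length_cons]
    split_ifs <;> linarith

@[simp] theorem steps_rootT (d k : ℕ) : (rootT d k).steps = 4 * k + 1 := by
  induction k with
  | zero => rfl
  | succ k ih => simp [rootT, ih]; ring

/-- Minimality of the root r is recorded as (r - 1)² < d. The escape r = k is harmless in the only
use, k = d, since d ≤ d². -/
theorem val_rootT_spec (d k : ℕ) :
    (d ≤ (rootT d k).val ^ 2 ∨ (rootT d k).val = k) ∧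
      ((rootT d k).val = 0 ∨ ((rootT d k).val - 1) ^ 2 < d) := by
  induction k with
  | zero => simp [rootT]
  | succ k ih =>
    obtain ⟨h₁, h₂⟩ := ih
    simp only [rootT, val_bind, val_ite, val_pure]
    split_ifs with h
    · exact ⟨Or.inl (by rw [sq]; exact h), h₂⟩
    · refine ⟨Or.inr rfl, Or.inr ?_⟩
      rw [← sq] at h
      rcases h₁ with h₁ | h₁
      · exact absurd h₁ h
      · simpa [h₁] using h

theorem le_sq_rootT (d : ℕ) : d ≤ (rootT d d).val ^ 2 := by
  rcases (val_rootT_spec d d).1 with h | h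
  · exact h
  · rw [h, sq]; exact Nat.le_mul_self d

/-- Minimality gives (r - 1)² + 1 ≤ d, and r² ≤ 2((r - 1)² + 1); the looser factor 4 has a rational
root. -/
theorem sq_rootT_le (d : ℕ) : (rootT d d).val ^ 2 ≤ 4 * d := by
  rcases (val_rootT_spec d d).2 with h | h
  · simp [h]
  · generalize (rootT d d).val = r at h ⊢
    rcases r with _ | r
    · simp
    · simp only [Nat.add_sub_cancel] at h
      nlinarith [sq_nonneg ((r : ℤ) - 1), sq_nonneg (r - 1), Nat.le_self_pow two_ne_zero r]

@[simp] theorem val_removeT [DecidableEq α] (a : α) (l : List α) :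
    (removeT a l).val = l.filter (· ≠ a) := by
  simp [removeT, eq_comm]

theorem steps_removeT_le [DecidableEq α] (a : α) (l : List α) :
    (removeT a l).steps ≤ 2 * l.length + 1 := by
  have := steps_filterT_le (p := fun x => do let b ← eqT a x; pure (!b)) (l := l) (k := 1)
    (by simp)
  rw [removeT]
  linarith

theorem pair_sublist_cons {a b x : α} {l : List α} :
    [a, b].Sublist (x :: l) ↔ [a, b].Sublist l ∨ a = x ∧ b ∈ l := by
  rw [List.sublist_cons_iff]
  simp

theorem pair_sublist_concat {a b x : α} {l : List α} :
    [a, b].Sublist (l ++ [x]) ↔ [a, b].Sublist l ∨ a ∈ l ∧ b = x := by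
  induction l with
  | nil => simp
  | cons y l ih =>
    rw [List.cons_append, pair_sublist_cons, pair_sublist_cons, ih]
    simp only [List.mem_append, List.mem_cons, List.not_mem_nil, or_false]
    grind

/-- The search stops at the first `a` without looking for `b`, so `b` must be known to occur. It
also stops at the first `b`, so no repetition may follow. -/
theorem val_beforeT [DecidableEq α] {a b : α} {l : List α} (hl : l.Nodup) (hb : b ∈ l)
    (hab : a ≠ b) : (beforeT a b l).val = decide ([a, b].Sublist l) := by
  induction l with
  | nil => simp at hb
  | cons x l ih =>
    rw [List.nodup_cons] at hl
    simp only [beforeT, val_bind, val_ite, val_pure, val_eqT, decide_eq_true_eq]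
    rw [Bool.eq_iff_iff, decide_eq_true_eq, pair_sublist_cons]
    have hsub : [a, b].Sublist l → b ∈ l := fun h => h.subset (by simp)
    split_ifs with h h'
    · subst h
      simp_all
      grind
    · subst h'
      simp only [false_iff]
      grind
    · rw [ih hl.2 (by grind)]
      grind

theorem steps_beforeT_le [DecidableEq α] (a b : α) (l : List α) :
    (beforeT a b l).steps ≤ 3 * l.length + 1 := by
  induction l with
  | nil => simp [beforeT]
  | cons x l ih =>
    simp only [beforeT, steps_bind, steps_charge, steps_ite, steps_pure, List.length_cons,
      steps_eqT]
    split_ifs <;> linarith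

end Loops

/-! ### The potential of a single vertex -/

section Potential

/-- Truncated subtraction differs from the integer one only at `a = 0`, where the factor `a`
vanishes. -/
theorem mul_pred_cast (a : ℕ) (G : ℤ → ℤ) :
    (a : ℤ) * G ((a - 1 : ℕ) : ℤ) = a * G ((a : ℤ) - 1) := by
  cases a <;> simp

/-- The potential is at most its expected value after one step of the removal of the vertices in
random order. -/
theorem potential_le_average (L a b : ℕ) :
    (1 + a + b : ℤ) * potential L a b ≤ 60 * (L : ℤ) ^ 3 * |(a : ℤ) - b| +
      a * potential L (a - 1) b + b * potential L a (b - 1) := by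
  have hL : (0 : ℤ) ≤ (L : ℤ) ^ 3 := by positivity
  have ha : (0 : ℤ) ≤ a := by positivity
  have hb : (0 : ℤ) ≤ b := by positivity
  -- Jensen's bound: in random order each neighbour is still present with probability 1/2 when the
  -- vertex is removed, so the expected signed imbalance is (a - b)/2.
  set g : ℤ → ℤ → ℤ := fun a b => 30 * (L : ℤ) ^ 3 * |a - b| with hg
  -- The exact expectation of 90L²y² - 60y⁴, where y is the imbalance at the time of removal.
  set f : ℤ → ℤ → ℤ := fun a b =>
    15 * (L : ℤ) ^ 2 * (2 * (a - b) ^ 2 + (a + b)) - 12 * (a - b) ^ 4 -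
      18 * (a - b) ^ 2 * (a + b) + 4 * (a - b) ^ 2 - 6 * (a + b) ^ 2 + 2 * (a + b) with hf
  have hpot : ∀ a b : ℕ, potential L a b = max (g a b) (f a b) := fun a b => rfl
  have hg₁ : ∀ a b : ℕ, g a b ≤ potential L a b :=
    fun a b => (le_max_left _ _).trans_eq (hpot a b).symm
  have hf₁ : ∀ a b : ℕ, f a b ≤ potential L a b :=
    fun a b => (le_max_right _ _).trans_eq (hpot a b).symm
  -- On the right-hand side the potential dominates both bounds, so it is enough to treat the one
  -- that attains the maximum on the left.
  rcases max_choice (g a b) (f a b) with h | h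
  · rw [hpot a b, h]
    have h₁ := mul_le_mul_of_nonneg_left (hg₁ (a - 1) b) ha
    have h₂ := mul_le_mul_of_nonneg_left (hg₁ a (b - 1)) hb
    rw [mul_pred_cast a (fun x => g x b)] at h₁
    rw [mul_pred_cast b (fun x => g a x)] at h₂
    -- With D = a - b, a(D - 1) + b(D + 1) = (a + b - 1)D; adding 2D gives equality, and absolute
    -- values only increase the right-hand side.
    have key : (1 + a + b : ℤ) * |(a : ℤ) - b| ≤
        2 * |(a : ℤ) - b| + a * |(a : ℤ) - 1 - b| + b * |(a : ℤ) - (b - 1)| := by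
      rcases le_total 0 ((a : ℤ) - b) with hD | hD
      · rw [abs_of_nonneg hD]
        nlinarith [mul_le_mul_of_nonneg_left (le_abs_self ((a : ℤ) - 1 - b)) ha,
          mul_le_mul_of_nonneg_left (le_abs_self ((a : ℤ) - (b - 1))) hb]
      · rw [abs_of_nonpos hD]
        nlinarith [mul_le_mul_of_nonneg_left (neg_abs_le ((a : ℤ) - 1 - b)) ha,
          mul_le_mul_of_nonneg_left (neg_abs_le ((a : ℤ) - (b - 1))) hb]
    have := mul_le_mul_of_nonneg_left key hL
    simp only [hg] at h₁ h₂ ⊢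
    linarith
  · rw [hpot a b, h]
    have h₁ := mul_le_mul_of_nonneg_left (hf₁ (a - 1) b) ha
    have h₂ := mul_le_mul_of_nonneg_left (hf₁ a (b - 1)) hb
    rw [mul_pred_cast a (fun x => f x b)] at h₁
    rw [mul_pred_cast b (fun x => f a x)] at h₂
    -- The exact recursion of that expectation: among the vertex and its a + b neighbours, each is
    -- equally likely to be removed first.
    have key : (1 + a + b : ℤ) * f a b - 90 * (L : ℤ) ^ 2 * ((a : ℤ) - b) ^ 2 +
        60 * ((a : ℤ) - b) ^ 4 = a * f (a - 1) b + b * f a (b - 1) := by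
      simp only [hf]; ring
    have hy : 0 ≤ |(a : ℤ) - b| := abs_nonneg _
    have key' : 0 ≤ 60 * (L : ℤ) ^ 3 * |(a : ℤ) - b| - 90 * (L : ℤ) ^ 2 * ((a : ℤ) - b) ^ 2 +
        60 * ((a : ℤ) - b) ^ 4 := by
      have e₄ : ((a : ℤ) - b) ^ 4 = |(a : ℤ) - b| ^ 4 := by
        rw [show 4 = 2 * 2 by rfl, pow_mul, pow_mul, sq_abs]
      rw [← sq_abs ((a : ℤ) - b), e₄]
      generalize |(a : ℤ) - b| = y at hy
      have hL' : (0 : ℤ) ≤ L := by positivity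
      have : 0 ≤ 32 * (2 * (L : ℤ) ^ 3 - 3 * (L : ℤ) ^ 2 * y + 2 * y ^ 3) := by
        -- For y ≥ 0 the cubic is smallest at y = L/√2. The square vanishes at the nearby rational
        -- point 3L/4, which leaves a nonnegative remainder.
        have e : 32 * (2 * (L : ℤ) ^ 3 - 3 * (L : ℤ) ^ 2 * y + 2 * y ^ 3) =
          2 * (2 * y + 3 * L) * (4 * y - 3 * L) ^ 2 + 10 * (L : ℤ) ^ 3 + 12 * y * (L : ℤ) ^ 2 := by
          ring
        rw [e]; positivity
      have h32 : 0 ≤ 2 * (L : ℤ) ^ 3 - 3 * (L : ℤ) ^ 2 * y + 2 * y ^ 3 := by linarith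
      nlinarith [mul_nonneg hy h32]
    linarith

/-- If |a - b| ≥ L, the linear bound is at least 30L⁴ and a + b ≤ L² suffices. Otherwise the quartic
terms are absorbed by the quadratic ones. -/
theorem le_potential {L a b : ℕ} (h : a + b ≤ L ^ 2) :
    9 * (L : ℤ) ^ 2 * (a + b) ≤ potential L a b := by
  unfold potential
  have hd : (a : ℤ) + b ≤ (L : ℤ) ^ 2 := by exact_mod_cast h
  have hd0 : (0 : ℤ) ≤ a + b := by positivity
  have hL : (0 : ℤ) ≤ L := by positivity
  rw [le_max_iff]
  rcases le_total (L : ℤ) |(a : ℤ) - b| with hD | hD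
  · left
    have h₁ : (L : ℤ) ^ 3 * L ≤ (L : ℤ) ^ 3 * |(a : ℤ) - b| :=
      mul_le_mul_of_nonneg_left hD (by positivity)
    have h₂ : (L : ℤ) ^ 2 * (a + b) ≤ (L : ℤ) ^ 2 * (L : ℤ) ^ 2 :=
      mul_le_mul_of_nonneg_left hd (by positivity)
    have h₃ : (0 : ℤ) ≤ (L : ℤ) ^ 2 * (a + b) := by positivity
    nlinarith
  · right
    have hD2 : ((a : ℤ) - b) ^ 2 ≤ (L : ℤ) ^ 2 := sq_le_sq'
      (by linarith [neg_abs_le ((a : ℤ) - b)]) (by linarith [le_abs_self ((a : ℤ) - b)])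
    generalize (a : ℤ) - b = D at *
    generalize (a : ℤ) + b = d at *
    generalize (L : ℤ) ^ 2 = M at *
    -- The difference of the two sides is 12D²(M - D²) + 18D²(M - d) + 6d(M - d) + 4D² + 2d.
    nlinarith [mul_nonneg (sub_nonneg.2 hD2) (sq_nonneg D),
      mul_nonneg (sub_nonneg.2 hd) (sq_nonneg D),
      mul_nonneg (sub_nonneg.2 hd) hd0, sq_nonneg D]

end Potential

/-! ### Total potential and the greedy removal of vertices -/

section Degrees

theorem pair_sublist_mem {α : Type} {a b : α} {l : List α} (h : [a, b].Sublist l) : a ∈ l ∧ b ∈ l :=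
  ⟨h.subset (by simp), h.subset (by simp)⟩

theorem ne_of_mem {α : Type} {E : List (α × α)} (hirr : ∀ a, (a, a) ∉ E) {e : α × α}
    (he : e ∈ E) : e.1 ≠ e.2 := by
  obtain ⟨a, b⟩ := e
  rintro (rfl : a = b)
  exact hirr a he

variable {α : Type} [DecidableEq α]

/-- The number of arcs from vertices in `R` to `v`. -/
def inDeg (E : List (α × α)) (R : List α) (v : α) : ℕ :=
  E.countP (fun e => e.2 = v ∧ e.1 ∈ R)

/-- The number of arcs from `v` to vertices in `R`. -/
def outDeg (E : List (α × α)) (R : List α) (v : α) : ℕ :=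
  E.countP (fun e => e.1 = v ∧ e.2 ∈ R)

/-- The sum of the potentials of the vertices of the subgraph on `R`. -/
def totalPotential (E : List (α × α)) (L : ℕ) (R : List α) : ℤ :=
  (R.map fun v => potential L (inDeg E R v) (outDeg E R v)).sum

@[simp] theorem val_inDegT (E : List (α × α)) (R : List α) (v : α) :
    (inDegT E R v).val = inDeg E R v := by
  simp only [inDegT, val_countT, inDeg]
  congr 1; funext e
  by_cases h : e.2 = v <;> simp [h]

@[simp] theorem val_outDegT (E : List (α × α)) (R : List α) (v : α) :
    (outDegT E R v).val = outDeg E R v := by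
  simp only [outDegT, val_countT, outDeg]
  congr 1; funext e
  by_cases h : e.1 = v <;> simp [h]

@[simp] theorem val_potentialT (E : List (α × α)) (L : ℕ) (R : List α) (v : α) :
    (potentialT E L R v).val = potential L (inDeg E R v) (outDeg E R v) := by
  simp [potentialT]

@[simp] theorem val_scoreT (E : List (α × α)) (L : ℕ) (R : List α) (x : α) :
    (scoreT E L R x).val = 60 * (L : ℤ) ^ 3 * |(inDeg E R x : ℤ) - outDeg E R x| +
      totalPotential E L (R.filter (· ≠ x)) := by
  simp [scoreT, totalPotential]

/-- Counting neighbours instead of arcs turns the removal of a vertex into `Finset.erase`. -/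
theorem inDeg_eq_card {E : List (α × α)} (hE : E.Nodup) (R : List α) (v : α) :
    inDeg E R v = (R.toFinset.filter fun x => (x, v) ∈ E).card := by
  rw [inDeg, List.countP_eq_length_filter, ← List.toFinset_card_of_nodup (hE.filter _)]
  refine Finset.card_bij (fun e _ => e.1) ?_ ?_ ?_
  · rintro ⟨a, b⟩ h
    simp only [List.mem_toFinset, List.mem_filter, decide_eq_true_eq, Finset.mem_filter] at h ⊢
    grind
  · rintro ⟨a, b⟩ h ⟨a', b'⟩ h' e
    simp only [List.mem_toFinset, List.mem_filter, decide_eq_true_eq] at h h'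
    grind
  · rintro a h
    simp only [List.mem_toFinset, Finset.mem_filter] at h
    exact ⟨(a, v), by simp [h], rfl⟩

theorem outDeg_eq_card {E : List (α × α)} (hE : E.Nodup) (R : List α) (v : α) :
    outDeg E R v = (R.toFinset.filter fun x => (v, x) ∈ E).card := by
  rw [outDeg, List.countP_eq_length_filter, ← List.toFinset_card_of_nodup (hE.filter _)]
  refine Finset.card_bij (fun e _ => e.2) ?_ ?_ ?_
  · rintro ⟨a, b⟩ h
    simp only [List.mem_toFinset, List.mem_filter, decide_eq_true_eq, Finset.mem_filter] at h ⊢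
    grind
  · rintro ⟨a, b⟩ h ⟨a', b'⟩ h' e
    simp only [List.mem_toFinset, List.mem_filter, decide_eq_true_eq] at h h'
    grind
  · rintro a h
    simp only [List.mem_toFinset, Finset.mem_filter] at h
    exact ⟨(v, a), by simp [h], rfl⟩

theorem filter_ne_toFinset (R : List α) (x : α) :
    (R.filter (· ≠ x)).toFinset = R.toFinset.erase x := by
  ext y; simp [and_comm]

theorem inDeg_remove {E : List (α × α)} (hE : E.Nodup) {R : List α} {x : α} (hx : x ∈ R)
    (v : α) : inDeg E (R.filter (· ≠ x)) v = inDeg E R v - if (x, v) ∈ E then 1 else 0 := by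
  rw [inDeg_eq_card hE, inDeg_eq_card hE, filter_ne_toFinset, Finset.filter_erase]
  split_ifs with h
  · rw [Finset.card_erase_of_mem (by simp [hx, h])]
  · rw [Finset.erase_eq_of_notMem (by simp [h])]; rfl

theorem outDeg_remove {E : List (α × α)} (hE : E.Nodup) {R : List α} {x : α} (hx : x ∈ R)
    (v : α) : outDeg E (R.filter (· ≠ x)) v = outDeg E R v - if (v, x) ∈ E then 1 else 0 := by
  rw [outDeg_eq_card hE, outDeg_eq_card hE, filter_ne_toFinset, Finset.filter_erase]
  split_ifs with h
  · rw [Finset.card_erase_of_mem (by simp [hx, h])]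
  · rw [Finset.erase_eq_of_notMem (by simp [h])]; rfl

theorem totalPotential_eq_sum (E : List (α × α)) (L : ℕ) {R : List α} (hR : R.Nodup) :
    totalPotential E L R =
      ∑ v ∈ R.toFinset, potential L (inDeg E R v) (outDeg E R v) := by
  rw [List.sum_toFinset _ hR]; rfl

/-- The average of the scores of the vertices is at least the total potential. -/
theorem totalPotential_le_average {E : List (α × α)} (hE : E.Nodup)
    (hasymm : ∀ a b, (a, b) ∈ E → (b, a) ∉ E) (L : ℕ) {R : List α} (hR : R.Nodup) :
    (R.toFinset.card : ℤ) * totalPotential E L R ≤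
      ∑ x ∈ R.toFinset, (60 * (L : ℤ) ^ 3 * |(inDeg E R x : ℤ) - outDeg E R x| +
        totalPotential E L (R.filter (· ≠ x))) := by
  have hirr : ∀ a, (a, a) ∉ E := fun a h => hasymm a a h h
  have h₁ : ∀ x ∈ R.toFinset, totalPotential E L (R.filter (· ≠ x)) =
      ∑ v ∈ R.toFinset, if v ≠ x then potential L (inDeg E (R.filter (· ≠ x)) v)
        (outDeg E (R.filter (· ≠ x)) v) else 0 := by
    intro x _
    rw [totalPotential_eq_sum E L (hR.filter _), ← Finset.sum_filter]
    congr 1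
    ext y; simp
  -- After the sums are exchanged, the claim splits into one instance of `potential_le_average` for
  -- each vertex `v`.
  rw [Finset.sum_add_distrib, Finset.sum_congr rfl h₁, Finset.sum_comm, ← Finset.sum_add_distrib,
    totalPotential_eq_sum E L hR, Finset.mul_sum]
  refine Finset.sum_le_sum fun v hv => ?_
  -- Only the removal of `v` or of a neighbour of `v` changes its term. No vertex is both an in- and
  -- an out-neighbour, so the corrections can be added.
  have h₂ : ∀ x ∈ R.toFinset, (if v ≠ x then potential L (inDeg E (R.filter (· ≠ x)) v)
        (outDeg E (R.filter (· ≠ x)) v) else 0) =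
      potential L (inDeg E R v) (outDeg E R v) -
      (if x = v then potential L (inDeg E R v) (outDeg E R v) else 0) +
      ((if (x, v) ∈ E then potential L (inDeg E R v - 1) (outDeg E R v) -
        potential L (inDeg E R v) (outDeg E R v) else 0) +
      if (v, x) ∈ E then potential L (inDeg E R v) (outDeg E R v - 1) -
        potential L (inDeg E R v) (outDeg E R v) else 0) := by
    intro x hx
    rw [List.mem_toFinset] at hx
    rw [inDeg_remove hE hx, outDeg_remove hE hx]
    by_cases hxv : x = v
    · subst hxv
      simp [hirr]
    · by_cases hi : (x, v) ∈ E
      · simp [hi, hasymm _ _ hi, hxv, Ne.symm hxv]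
      · by_cases ho : (v, x) ∈ E <;> simp [hi, ho, hxv, Ne.symm hxv]
  rw [Finset.sum_congr rfl h₂]
  simp only [Finset.sum_add_distrib, Finset.sum_sub_distrib, Finset.sum_const, nsmul_eq_mul,
    Finset.sum_ite_eq', hv, if_true, ← Finset.sum_filter, ← inDeg_eq_card hE,
    ← outDeg_eq_card hE]
  have := potential_le_average L (inDeg E R v) (outDeg E R v)
  linarith

/-- The method of conditional expectations: some score reaches the average. -/
theorem exists_totalPotential_le {E : List (α × α)} (hE : E.Nodup)
    (hasymm : ∀ a b, (a, b) ∈ E → (b, a) ∉ E) (L : ℕ) {R : List α} (hR : R.Nodup) (h0 : R ≠ []) :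
    ∃ x ∈ R, totalPotential E L R ≤ (scoreT E L R x).val := by
  have h := totalPotential_le_average hE hasymm L hR
  rw [← nsmul_eq_mul, ← Finset.sum_const] at h
  obtain ⟨x, hx, hle⟩ := Finset.exists_le_of_sum_le (List.toFinset_nonempty_iff R |>.2 h0) h
  exact ⟨x, List.mem_toFinset.1 hx, by simpa using hle⟩

/-- The number of arcs in `E` that lead forward in the list `o`. -/
def forward (E : List (α × α)) (o : List α) : ℕ :=
  E.countP fun e => [e.1, e.2].Sublist o

/-- The number of arcs in `E` between elements of `R`. -/
def inner (E : List (α × α)) (R : List α) : ℕ :=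
  E.countP fun e => e.1 ∈ R ∧ e.2 ∈ R

theorem countP_eq_add {β : Type} {p q r : β → Bool} {l : List β}
    (h : ∀ x ∈ l, (if p x then 1 else 0) = (if q x then 1 else 0) + if r x then 1 else 0) :
    l.countP p = l.countP q + l.countP r := by
  induction l with
  | nil => rfl
  | cons x l ih =>
    have := h x (by simp)
    rw [List.countP_cons, List.countP_cons, List.countP_cons,
      ih fun y hy => h y (by simp [hy])]
    omega

theorem forward_cons (E : List (α × α)) {x : α} {o : List α} (hx : x ∉ o) :
    forward E (x :: o) = forward E o + outDeg E o x := by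
  refine countP_eq_add fun e _ => ?_
  have := @pair_sublist_mem α e.1 e.2 o
  simp only [decide_eq_true_eq, pair_sublist_cons]
  grind

theorem forward_concat (E : List (α × α)) {x : α} {o : List α} (hx : x ∉ o) :
    forward E (o ++ [x]) = forward E o + inDeg E o x := by
  refine countP_eq_add fun e _ => ?_
  have := @pair_sublist_mem α e.1 e.2 o
  simp only [decide_eq_true_eq, pair_sublist_concat]
  grind

theorem inDeg_congr (E : List (α × α)) {R R' : List α} (h : ∀ x, x ∈ R ↔ x ∈ R') (v : α) :
    inDeg E R v = inDeg E R' v := by simp [inDeg, h]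

theorem outDeg_congr (E : List (α × α)) {R R' : List α} (h : ∀ x, x ∈ R ↔ x ∈ R') (v : α) :
    outDeg E R v = outDeg E R' v := by simp [outDeg, h]

theorem inner_remove {E : List (α × α)} (hirr : ∀ a, (a, a) ∉ E) {R : List α} {x : α}
    (hx : x ∈ R) :
    inner E R = inner E (R.filter (· ≠ x)) + (inDeg E R x + outDeg E R x) := by
  have h : inDeg E R x + outDeg E R x =
      E.countP fun e => (e.2 = x ∧ e.1 ∈ R) ∨ (e.1 = x ∧ e.2 ∈ R) := by
    refine (countP_eq_add fun e he => ?_).symm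
    have : e.1 ≠ e.2 := ne_of_mem hirr he
    simp only [decide_eq_true_eq]
    grind
  rw [h]
  refine countP_eq_add fun e he => ?_
  simp only [decide_eq_true_eq, List.mem_filter]
  grind

theorem perm_cons_filter_ne {R : List α} (hR : R.Nodup) {x : α} (hx : x ∈ R) :
    (x :: R.filter (· ≠ x)).Perm R := by
  rw [List.perm_ext_iff_of_nodup (List.nodup_cons.2 ⟨by simp, hR.filter _⟩) hR]
  intro y
  by_cases h : y = x <;> simp [h, hx]

theorem length_filter_ne {R : List α} (hR : R.Nodup) {x : α} (hx : x ∈ R) :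
    (R.filter (· ≠ x)).length + 1 = R.length :=
  (perm_cons_filter_ne hR hx).length_eq

/-- Removing `x` with `a` entering and `b` leaving arcs takes a + b inner arcs and yields max(a, b)
forward ones, and 120 max(a, b) = 60(a + b) + 60|a - b|. The last term is the gain counted in the
score, which makes up for the loss of potential. -/
theorem peelT_spec {E : List (α × α)} (hE : E.Nodup)
    (hasymm : ∀ a b, (a, b) ∈ E → (b, a) ∉ E) (L k : ℕ) {R : List α} (hR : R.Nodup)
    (hk : R.length ≤ k) :
    (peelT E L k R).val.Perm R ∧ 60 * (L : ℤ) ^ 3 * inner E R + totalPotential E L R ≤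
      120 * (L : ℤ) ^ 3 * forward E (peelT E L k R).val := by
  induction k generalizing R with
  | zero =>
    obtain rfl : R = [] := by simpa using hk
    simp [peelT, inner, totalPotential, forward]
  | succ k ih =>
    simp only [peelT, val_bind]
    split
    · rename_i h
      obtain rfl := argmaxT_eq_none h
      simp [inner, totalPotential, forward]
    · rename_i x m h
      obtain ⟨hx, hm, hmax⟩ := argmaxT_eq_some h
      obtain ⟨y, hy, hyΦ⟩ := exists_totalPotential_le hE hasymm L hR (List.ne_nil_of_mem hx)
      have hscore := hyΦ.trans (hmax y hy)
      rw [← hm, val_scoreT] at hscore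
      have hirr : ∀ a, (a, a) ∉ E := fun a h => hasymm a a h h
      have hl := length_filter_ne hR hx
      have hp := perm_cons_filter_ne hR hx
      simp only [val_bind, val_inDegT, val_outDegT, val_removeT, val_ite, val_pure, val_appendT]
      obtain ⟨ih₁, ih₂⟩ := ih (hR.filter (· ≠ x)) (by omega)
      -- Without loops, the degrees of `x` do not depend on whether `x` itself is in the list.
      have hin : inDeg E (peelT E L k (R.filter (· ≠ x))).val x = inDeg E R x := by
        rw [inDeg_congr E (fun _ => ih₁.mem_iff), inDeg_remove hE hx, if_neg (hirr x)]; rfl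
      have hout : outDeg E (peelT E L k (R.filter (· ≠ x))).val x = outDeg E R x := by
        rw [outDeg_congr E (fun _ => ih₁.mem_iff), outDeg_remove hE hx, if_neg (hirr x)]; rfl
      have hxo : x ∉ (peelT E L k (R.filter (· ≠ x))).val := by
        rw [ih₁.mem_iff]; simp
      rw [inner_remove hirr hx]
      generalize (peelT E L k (R.filter (· ≠ x))).val = o at *
      split_ifs with hab
      · refine ⟨(ih₁.cons x).trans hp, ?_⟩
        rw [forward_cons E hxo, hout]
        have : |(inDeg E R x : ℤ) - outDeg E R x| = outDeg E R x - inDeg E R x := by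
          rw [abs_of_nonpos (by simpa using hab)]; ring
        rw [this] at hscore
        push_cast
        linarith
      · refine ⟨((List.perm_append_singleton x o).trans (ih₁.cons x)).trans hp, ?_⟩
        rw [forward_concat E hxo, hin]
        have : |(inDeg E R x : ℤ) - outDeg E R x| = inDeg E R x - outDeg E R x := by
          rw [abs_of_nonneg (by simpa using (not_le.1 hab).le)]
        rw [this] at hscore
        push_cast
        linarith

theorem sum_inDeg {E : List (α × α)} {V : List α} (hV : ∀ e ∈ E, e.1 ∈ V ∧ e.2 ∈ V) :
    ∑ v ∈ V.toFinset, inDeg E V v = E.length := by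
  have : ∀ v, inDeg E V v = E.countP fun e => e.2 = v := fun v =>
    List.countP_congr fun e he => by simp [hV e he]
  simp only [this]
  clear this
  induction E with
  | nil => simp
  | cons e E ih =>
    simp only [List.countP_cons, Finset.sum_add_distrib,
      ih fun f hf => hV f (by simp [hf])]
    simp [hV e (by simp)]

theorem sum_outDeg {E : List (α × α)} {V : List α} (hV : ∀ e ∈ E, e.1 ∈ V ∧ e.2 ∈ V) :
    ∑ v ∈ V.toFinset, outDeg E V v = E.length := by
  have : ∀ v, outDeg E V v = E.countP fun e => e.1 = v := fun v =>
    List.countP_congr fun e he => by simp [hV e he]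
  simp only [this]
  clear this
  induction E with
  | nil => simp
  | cons e E ih =>
    simp only [List.countP_cons, Finset.sum_add_distrib,
      ih fun f hf => hV f (by simp [hf])]
    simp [hV e (by simp)]

theorem inDeg_add_outDeg_le_degree {E : List (α × α)} (hirr : ∀ a, (a, a) ∉ E) (R : List α)
    (v : α) : inDeg E R v + outDeg E R v ≤ degree E v := by
  have h : inDeg E R v + outDeg E R v =
      E.countP fun e => (e.2 = v ∧ e.1 ∈ R) ∨ (e.1 = v ∧ e.2 ∈ R) := by
    refine (countP_eq_add fun e he => ?_).symm
    have : e.1 ≠ e.2 := ne_of_mem hirr he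
    simp only [decide_eq_true_eq]
    grind
  rw [h]
  refine List.countP_mono_left fun e _ => ?_
  simp only [decide_eq_true_eq]
  tauto

end Degrees

/-! ### The ratio of the algorithm for acyclic subgraphs -/

section Approximation

variable {α : Type} [DecidableEq α]

/-- No assumption on the graph is made: this serves the step counts. -/
theorem length_peelT_le (E : List (α × α)) (L k : ℕ) (R : List α) :
    (peelT E L k R).val.length ≤ k := by
  induction k generalizing R with
  | zero => simp [peelT]
  | succ k ih =>
    simp only [peelT, val_bind]
    split
    · simp
    · rename_i x m h
      have := ih (R.filter (· ≠ x))
      simp only [val_bind, val_removeT, val_ite, val_pure, val_appendT]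
      split_ifs <;> simpa using this

/-- Only `b` has to be unique, since `idxOf` takes the first occurrence of `a`. -/
theorem idxOf_lt_of_pair_sublist {a b : α} {l : List α} (hb : l.count b ≤ 1)
    (h : [a, b].Sublist l) : l.idxOf a < l.idxOf b := by
  induction l with
  | nil => simp at h
  | cons x l ih =>
    rw [pair_sublist_cons] at h
    rw [List.count_cons] at hb
    have hmem : b ∈ l := by
      rcases h with h | h
      · exact (pair_sublist_mem h).2
      · exact h.2
    have hc := List.count_pos_iff.2 hmem
    have hxb : x ≠ b := by
      rintro rfl
      simp at hb
      omega
    by_cases hax : x = a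
    · simp [hax, hax ▸ hxb]
    · have := ih (by omega) (by grind)
      simp [hax, hxb, this]

theorem pair_sublist_of_idxOf_lt {a b : α} {l : List α} (hb : b ∈ l)
    (h : l.idxOf a < l.idxOf b) : [a, b].Sublist l := by
  induction l with
  | nil => simp at hb
  | cons x l ih =>
    rw [pair_sublist_cons]
    by_cases hxb : x = b
    · simp [List.idxOf_cons, hxb] at h
    · have hbl : b ∈ l := by grind
      by_cases hxa : x = a
      · exact Or.inr ⟨hxa.symm, hbl⟩
      · refine Or.inl (ih hbl ?_)
        simpa [List.idxOf_cons, hxa, hxb] using h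

theorem acyclic_of_idxOf_lt {A : List (α × α)} (o : List α)
    (h : ∀ e ∈ A, o.idxOf e.1 < o.idxOf e.2) : Acyclic A := by
  intro v hv
  have : ∀ a b, Relation.TransGen (fun a b => (a, b) ∈ A) a b → o.idxOf a < o.idxOf b := by
    intro a b hab
    induction hab with
    | single h' => exact h _ h'
    | tail _ h' ih => exact ih.trans (h _ h')
  exact lt_irrefl _ (this v v hv)

theorem forward_append_filter (E : List (α × α)) (o : List α) (p : α × α → Bool) :
    forward E o = forward (E.filter p) o + forward (E.filter fun e => !p e) o := by
  rw [forward, forward, forward, List.countP_filter, List.countP_filter]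
  exact countP_eq_add fun e _ => by cases p e <;> simp

/-- Of the arcs on directed 2-cycles, half lead forward. -/
theorem two_mul_forward_eq {E : List (α × α)} (hE : E.Nodup) (hirr : ∀ a, (a, a) ∉ E)
    (hsymm : ∀ e ∈ E, e.swap ∈ E) {o : List α} (ho : o.Nodup)
    (hmem : ∀ e ∈ E, e.1 ∈ o ∧ e.2 ∈ o) : 2 * forward E o = E.length := by
  have hperm : (E.map Prod.swap).Perm E := by
    rw [List.perm_ext_iff_of_nodup (hE.map Prod.swap_injective) hE]
    intro e
    simp only [List.mem_map]
    constructor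
    · rintro ⟨f, hf, rfl⟩
      exact hsymm f hf
    · intro he
      exact ⟨e.swap, hsymm e he, Prod.swap_swap e⟩
  -- Reversal permutes `E` and exchanges forward and backward arcs.
  have h₁ : forward E o = E.countP fun e => ¬ [e.1, e.2].Sublist o := by
    rw [forward, ← hperm.countP_eq, List.countP_map]
    refine List.countP_congr fun e he => ?_
    have hc : ∀ a, o.count a ≤ 1 := List.nodup_iff_count_le_one.1 ho
    simp only [Function.comp, Prod.fst_swap, Prod.snd_swap, decide_eq_true_eq, decide_not,
      Bool.not_eq_true', decide_eq_false_iff_not]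
    constructor
    · intro h h'
      exact lt_asymm (idxOf_lt_of_pair_sublist (hc _) h) (idxOf_lt_of_pair_sublist (hc _) h')
    · intro h
      have hne : o.idxOf e.1 ≠ o.idxOf e.2 := fun h =>
        ne_of_mem hirr he ((List.idxOf_inj (hmem e he).1).1 h)
      rcases hne.lt_or_gt with h' | h'
      · exact absurd (pair_sublist_of_idxOf_lt (hmem e he).2 h') h
      · exact pair_sublist_of_idxOf_lt (hmem e he).1 h'
  have h₂ := List.length_eq_countP_add_countP (fun e : α × α => decide ([e.1, e.2].Sublist o))
    (l := E)
  rw [two_mul]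
  nth_rewrite 2 [h₁]
  rw [h₂, forward]
  simp

/-- An acyclic subgraph contains at most half of the arcs on directed 2-cycles. -/
theorem two_mul_length_le {α : Type} {E B : List (α × α)} (hsymm : ∀ e ∈ E, e.swap ∈ E)
    (hB : IsAcyclicSubgraph E B) : 2 * B.length ≤ E.length := by
  obtain ⟨hn, hsub, hac⟩ := hB
  -- An arc of `B` whose reverse is also in `B` would close a directed cycle.
  have hnd : (B ++ B.map Prod.swap).Nodup := by
    refine List.nodup_append'.2 ⟨hn, hn.map Prod.swap_injective, ?_⟩
    rintro ⟨a, b⟩ h h'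
    simp only [List.mem_map, Prod.exists, Prod.swap_prod_mk, Prod.mk.injEq] at h'
    obtain ⟨b', a', h', rfl, rfl⟩ := h'
    exact hac a' (.tail (.single h) h')
  have hsub' : B ++ B.map Prod.swap ⊆ E := by
    intro e he
    rcases List.mem_append.1 he with he | he
    · exact hsub he
    · obtain ⟨f, hf, rfl⟩ := List.mem_map.1 he
      exact hsymm f (hsub hf)
  have := (hnd.subperm hsub').length_le
  simp only [List.length_append, List.length_map] at this
  omega

/-- The order in which `approxMAS` lists the vertices. -/
def peelOrder (V : List α) (E : List (α × α)) : List α :=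
  (peelT (E.filter fun e => !decide (e.swap ∈ E)) (rootT (maxDegree V E) (maxDegree V E)).val
    V.length V).val

theorem val_degreeT (E : List (α × α)) (v : α) :
    (countT (fun e : α × α => do
      let b ← eqT e.1 v
      if b then pure b else eqT e.2 v) E).val = degree E v := by
  simp only [val_countT, degree]
  congr 1; funext e
  by_cases h : e.1 = v <;> simp [h]

theorem val_oneWayT (E : List (α × α)) :
    (filterT (fun e => do
      let b ← memT (e.2, e.1) E
      pure (!b)) E).val = E.filter fun e => !decide (e.swap ∈ E) := by
  simp only [val_filterT, val_bind, val_pure, val_memT]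
  congr! 3
  exact decide_eq_decide.2 Iff.rfl

theorem val_approxMAS (V : List α) (E : List (α × α)) :
    (approxMAS V E).val = E.filter fun e => (beforeT e.1 e.2 (peelOrder V E)).val := by
  simp only [approxMAS, val_bind, val_oneWayT, val_maxT, val_degreeT, val_lengthT]
  rw [val_filterT]
  rfl

/-- The gain is claimed for the arcs without a reverse only, since the averaging argument needs an
asymmetric arc set. -/
theorem peelOrder_spec {V : List α} {E : List (α × α)} (h : IsDigraph V E) :
    (peelOrder V E).Perm V ∧
      (maxDegree V E ≠ 0 →
      (1 + 1 / 10 / √(maxDegree V E : ℝ)) / 2 *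
          ((E.filter fun e => !decide (e.swap ∈ E)).length : ℝ) ≤
        forward (E.filter fun e => !decide (e.swap ∈ E)) (peelOrder V E)) := by
  obtain ⟨hV, hE, hVE⟩ := h
  have hirr : ∀ a, (a, a) ∉ E := fun a ha => (hVE _ ha).2.2 rfl
  set E₁ := E.filter fun e => !decide (e.swap ∈ E) with hE₁
  have hE₁n : E₁.Nodup := hE.filter _
  have hE₁s : ∀ e ∈ E₁, e ∈ E := fun e he => List.mem_of_mem_filter he
  have hasymm : ∀ a b, (a, b) ∈ E₁ → (b, a) ∉ E₁ := by
    intro a b h h'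
    simp only [hE₁, List.mem_filter] at h h'
    simp [h'.1] at h
  set Δ := maxDegree V E with hΔ
  set L := (rootT Δ Δ).val with hL
  have hΔL : Δ ≤ L ^ 2 := le_sq_rootT Δ
  have hLΔ : L ^ 2 ≤ 4 * Δ := sq_rootT_le Δ
  obtain ⟨h₁, h₂⟩ := peelT_spec hE₁n hasymm L V.length hV le_rfl
  refine ⟨h₁, fun h0 => ?_⟩
  change _ ≤ 120 * (L : ℤ) ^ 3 * (forward E₁ (peelOrder V E) : ℤ) at h₂
  have hinner : inner E₁ V = E₁.length :=
    List.countP_eq_length.2 fun e he => by simp [hVE e (hE₁s e he)]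
  -- Each arc is counted at both of its ends, hence 18 = 2 · 9.
  have hΦ : 18 * (L : ℤ) ^ 2 * E₁.length ≤ totalPotential E₁ L V := by
    rw [totalPotential_eq_sum E₁ L hV]
    have hi := sum_inDeg (E := E₁) (V := V) fun e he =>
      ⟨(hVE e (hE₁s e he)).1, (hVE e (hE₁s e he)).2.1⟩
    have ho := sum_outDeg (E := E₁) (V := V) fun e he =>
      ⟨(hVE e (hE₁s e he)).1, (hVE e (hE₁s e he)).2.1⟩
    have : 18 * (L : ℤ) ^ 2 * E₁.length =
        ∑ v ∈ V.toFinset, 9 * (L : ℤ) ^ 2 * ((inDeg E₁ V v : ℤ) + outDeg E₁ V v) := by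
      rw [← Finset.mul_sum, Finset.sum_add_distrib, ← Nat.cast_sum, ← Nat.cast_sum, hi, ho]
      ring
    rw [this]
    refine Finset.sum_le_sum fun v hv => le_potential ?_
    calc inDeg E₁ V v + outDeg E₁ V v ≤ degree E₁ v :=
          inDeg_add_outDeg_le_degree (fun a ha => hirr a (hE₁s _ ha)) V v
      _ ≤ degree E v := List.Sublist.countP_le List.filter_sublist
      _ ≤ Δ := Finset.le_sup (f := degree E) hv
      _ ≤ L ^ 2 := hΔL
  rw [hinner] at h₂
  have hL0 : 0 < L := by
    rcases Nat.eq_zero_or_pos L with h | h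
    · rw [h] at hΔL; simp at hΔL; exact absurd hΔL h0
    · exact h
  have hmain : 60 * (L : ℤ) ^ 3 * E₁.length + 18 * (L : ℤ) ^ 2 * E₁.length ≤
      120 * (L : ℤ) ^ 3 * forward E₁ (peelOrder V E) := by linarith
  -- Division by 6L².
  have hmain' : (10 * L + 3 : ℤ) * E₁.length ≤ 20 * L * forward E₁ (peelOrder V E) := by
    have hpos : (0 : ℤ) < 6 * (L : ℤ) ^ 2 := by positivity
    refine le_of_mul_le_mul_left ?_ hpos
    linarith
  have hmainR : (10 * L + 3 : ℝ) * E₁.length ≤ 20 * L * forward E₁ (peelOrder V E) := by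
    exact_mod_cast hmain'
  have hs0 : 0 < √(Δ : ℝ) := Real.sqrt_pos.2 (by exact_mod_cast Nat.pos_of_ne_zero h0)
  have hLs : (L : ℝ) ≤ 2 * √(Δ : ℝ) := by
    refine (pow_le_pow_iff_left₀ (by positivity) (by positivity) two_ne_zero).1 ?_
    rw [mul_pow, Real.sq_sqrt (by positivity)]
    have : ((L ^ 2 : ℕ) : ℝ) ≤ ((4 * Δ : ℕ) : ℝ) := by exact_mod_cast hLΔ
    push_cast at this
    linarith
  have hLR : (0 : ℝ) < L := by exact_mod_cast hL0
  -- This is equivalent to L ≤ 3√Δ, so the constant 1/10 leaves some room.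
  have hc : 1 / 10 / √(Δ : ℝ) ≤ 3 / (10 * L) := by
    rw [div_div, div_le_div_iff₀ (by positivity) (by positivity)]
    linarith
  have hlen : (0 : ℝ) ≤ E₁.length := by positivity
  calc (1 + 1 / 10 / √(Δ : ℝ)) / 2 * (E₁.length : ℝ)
      ≤ (1 + 3 / (10 * L)) / 2 * (E₁.length : ℝ) := by gcongr
    _ = (10 * L + 3 : ℝ) * E₁.length / (20 * L) := by field_simp; ring
    _ ≤ forward E₁ (peelOrder V E) := by
      rw [div_le_iff₀ (by positivity)]
      linarith

theorem eq_nil_of_maxDegree_eq_zero {V : List α} {E : List (α × α)}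
    (hVE : ∀ e ∈ E, e.1 ∈ V) (h : maxDegree V E = 0) : E = [] := by
  rw [List.eq_nil_iff_forall_not_mem]
  intro e he
  have h₁ : degree E e.1 ≤ maxDegree V E :=
    Finset.le_sup (f := degree E) (List.mem_toFinset.2 (hVE e he))
  have h₂ : 0 < degree E e.1 := List.countP_pos_iff.2 ⟨e, he, by simp⟩
  omega

theorem approxMAS_spec {V : List α} {E : List (α × α)} (h : IsDigraph V E) :
    IsAcyclicSubgraph E (approxMAS V E).val ∧
    ∀ B, IsAcyclicSubgraph E B →
      (1 + 1 / 10 / √(maxDegree V E : ℝ)) / 2 * (B.length : ℝ) ≤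
        ((approxMAS V E).val.length : ℝ) := by
  have hspec := peelOrder_spec h
  obtain ⟨hV, hE, hVE⟩ := h
  have hirr : ∀ a, (a, a) ∉ E := fun a ha => (hVE _ ha).2.2 rfl
  rw [val_approxMAS]
  generalize peelOrder V E = o at hspec ⊢
  obtain ⟨hperm, hfw⟩ := hspec
  have ho : o.Nodup := hperm.nodup_iff.2 hV
  have hval : (E.filter fun e => (beforeT e.1 e.2 o).val) =
      E.filter fun e => [e.1, e.2].Sublist o :=
    List.filter_congr fun e he =>
      val_beforeT ho (hperm.mem_iff.2 (hVE e he).2.1) (hVE e he).2.2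
  rw [hval]
  refine ⟨⟨hE.filter _, List.filter_subset_self _, ?_⟩, ?_⟩
  · refine acyclic_of_idxOf_lt o fun e he => ?_
    rw [List.mem_filter, decide_eq_true_eq] at he
    exact idxOf_lt_of_pair_sublist (List.nodup_iff_count_le_one.1 ho _) he.2
  · rintro B ⟨hBn, hBE, hBac⟩
    -- Here the term `c / √0` is 0 and there are no arcs at all.
    by_cases h0 : maxDegree V E = 0
    · have hnil := eq_nil_of_maxDegree_eq_zero (fun e he => (hVE e he).1) h0
      have : B = [] := List.subset_nil.1 (hnil ▸ hBE)
      simp [this]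
    · have hfw := hfw h0
      rw [← List.countP_eq_length_filter]
      change _ ≤ (forward E o : ℝ)
      rw [forward_append_filter E o fun e => !decide (e.swap ∈ E)]
      have h₂ := two_mul_forward_eq (E := E.filter fun e => !!decide (e.swap ∈ E)) (hE.filter _)
        (fun a ha => hirr a (List.mem_of_mem_filter ha))
        (by
          intro e he
          simp only [Bool.not_not, List.mem_filter, decide_eq_true_eq, Prod.swap_swap] at he ⊢
          exact he.symm) ho
        (fun e he => by
          have := hVE e (List.mem_of_mem_filter he)
          exact ⟨hperm.mem_iff.2 this.1, hperm.mem_iff.2 this.2.1⟩)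
      have h₃ := two_mul_length_le (E := E.filter fun e => !!decide (e.swap ∈ E))
        (B := B.filter fun e => !!decide (e.swap ∈ E))
        (by
          intro e he
          simp only [Bool.not_not, List.mem_filter, decide_eq_true_eq, Prod.swap_swap] at he ⊢
          exact he.symm)
        ⟨hBn.filter _, fun e he => by
          rw [List.mem_filter] at he ⊢
          exact ⟨hBE he.1, he.2⟩, fun v hv => hBac v
            (Relation.TransGen.mono (fun _ _ hab => List.mem_of_mem_filter hab) _ _ hv)⟩
      have h₄ : (B.filter fun e => !decide (e.swap ∈ E)).length ≤
          (E.filter fun e => !decide (e.swap ∈ E)).length :=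
        ((hBn.filter _).subperm fun e he => by
          rw [List.mem_filter] at he ⊢
          exact ⟨hBE he.1, he.2⟩).length_le
      have h₅ := List.length_eq_length_filter_add (l := B) (fun e => !decide (e.swap ∈ E))
      generalize E.filter (fun e => !decide (e.swap ∈ E)) = E₁ at *
      generalize E.filter (fun e => !!decide (e.swap ∈ E)) = E₂ at *
      -- On 2-cycles the order does at least as well as `B`, so the factor (1 + q)/2 ≤ 1 is lost on
      -- `E₁` only.
      have h₆ : B.length ≤ E₁.length + forward E₂ o := by omega
      have h₆' : (B.length : ℝ) ≤ E₁.length + forward E₂ o := by exact_mod_cast h₆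
      have hs1 : 1 ≤ √(maxDegree V E : ℝ) :=
        Real.one_le_sqrt.2 (by exact_mod_cast Nat.one_le_iff_ne_zero.2 h0)
      have hq : 1 / 10 / √(maxDegree V E : ℝ) ≤ 1 := by
        rw [div_le_one (by positivity)]; linarith
      have hq0 : 0 ≤ 1 / 10 / √(maxDegree V E : ℝ) := by positivity
      generalize 1 / 10 / √(maxDegree V E : ℝ) = q at *
      have hf : (0 : ℝ) ≤ forward E₂ o := by positivity
      push_cast
      nlinarith

end Approximation

/-! ### Step count of the algorithm for acyclic subgraphs -/

section Steps

variable {α : Type} [DecidableEq α] {E : List (α × α)} {R : List α} {M : ℕ}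

theorem steps_inDegT_le (hM : 1 ≤ M) (hE : E.length ≤ M) (hR : R.length ≤ M) (v : α) :
    (inDegT E R v).steps ≤ 9 * M ^ 2 := by
  have : (inDegT E R v).steps ≤ E.length * (4 * M + 3) + 2 := by
    refine steps_countT_le fun e _ => ?_
    have := steps_memT_le e.1 R
    simp only [steps_bind, steps_eqT, steps_ite, steps_pure]
    split_ifs <;> omega
  nlinarith

theorem steps_outDegT_le (hM : 1 ≤ M) (hE : E.length ≤ M) (hR : R.length ≤ M) (v : α) :
    (outDegT E R v).steps ≤ 9 * M ^ 2 := by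
  have : (outDegT E R v).steps ≤ E.length * (4 * M + 3) + 2 := by
    refine steps_countT_le fun e _ => ?_
    have := steps_memT_le e.2 R
    simp only [steps_bind, steps_eqT, steps_ite, steps_pure]
    split_ifs <;> omega
  nlinarith

theorem steps_potentialT_le (hM : 1 ≤ M) (hE : E.length ≤ M) (hR : R.length ≤ M) (L : ℕ) (v : α) :
    (potentialT E L R v).steps ≤ 58 * M ^ 2 := by
  have h₁ := steps_inDegT_le hM hE hR v
  have h₂ := steps_outDegT_le hM hE hR v
  simp only [potentialT, steps_bind, steps_charge, steps_pure]
  nlinarith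

theorem steps_scoreT_le (hM : 1 ≤ M) (hE : E.length ≤ M) (hR : R.length ≤ M) (L : ℕ) (x : α) :
    (scoreT E L R x).steps ≤ 92 * M ^ 3 := by
  have h₁ := steps_inDegT_le hM hE hR x
  have h₂ := steps_outDegT_le hM hE hR x
  have h₃ := steps_removeT_le x R
  have hR' : (R.filter (· ≠ x)).length ≤ M := (List.length_filter_le _ _).trans hR
  have h₄ := steps_sumT_le (f := potentialT E L (R.filter (· ≠ x))) (l := R.filter (· ≠ x))
    fun v _ => steps_potentialT_le hM hE hR' L v
  simp only [scoreT, steps_bind, steps_charge, steps_pure, val_removeT]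
  have h₅ : (R.filter (· ≠ x)).length * (58 * M ^ 2 + 2) ≤ M * (58 * M ^ 2 + 2) :=
    Nat.mul_le_mul_right _ hR'
  have e₂ : M ≤ M ^ 3 := Nat.le_self_pow (by norm_num) M
  have e₃ : M ^ 2 ≤ M ^ 3 := Nat.pow_le_pow_right hM (by norm_num)
  have e₄ : M * (58 * M ^ 2 + 2) = 58 * M ^ 3 + 2 * M := by ring
  omega

/-- Each level is dominated by the search for the largest score: at most M candidates, at O(M³)
steps each. -/
theorem steps_peelT_le (hM : 1 ≤ M) (hE : E.length ≤ M) (hR : R.length ≤ M) (L : ℕ) {k : ℕ}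
    (hk : k ≤ M) : (peelT E L k R).steps ≤ k * (121 * M ^ 4) + 1 := by
  induction k generalizing R with
  | zero => simp [peelT]
  | succ k ih =>
    have h₁ := steps_argmaxT_le (f := scoreT E L R) (l := R)
      fun x _ => steps_scoreT_le hM hE hR L x
    have h₂ : R.length * (92 * M ^ 3 + 2) ≤ M * (92 * M ^ 3 + 2) := Nat.mul_le_mul_right _ hR
    have e₁ : M * (92 * M ^ 3 + 2) = 92 * M ^ 4 + 2 * M := by ring
    have e₂ : M ≤ M ^ 4 := Nat.le_self_pow (by norm_num) M
    have e₃ : M ^ 2 ≤ M ^ 4 := Nat.pow_le_pow_right hM (by norm_num)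
    have e₄ : (k + 1) * (121 * M ^ 4) = k * (121 * M ^ 4) + 121 * M ^ 4 := by ring
    simp only [peelT, steps_bind, steps_charge]
    split
    · simp only [steps_pure]
      omega
    · rename_i x m _
      have h₃ := steps_inDegT_le hM hE hR x
      have h₄ := steps_outDegT_le hM hE hR x
      have h₅ := steps_removeT_le x R
      have h₆ := ih ((List.length_filter_le (· ≠ x) _).trans hR) (by omega)
      have h₇ := length_peelT_le E L k (R.filter (· ≠ x))
      simp only [steps_bind, steps_ite, steps_pure, steps_appendT, val_removeT]
      split_ifs <;> omega

theorem steps_approxMAS_le (V : List α) (E : List (α × α)) :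
    (approxMAS V E).steps ≤ 151 * (V.length + E.length + 1) ^ 5 := by
  set M := V.length + E.length + 1 with hMdef
  have hM : 1 ≤ M := by omega
  have hE : E.length ≤ M := by omega
  have hV : V.length ≤ M := by omega
  have h₁ := steps_filterT_le (l := E) (k := 3 * M)
    (p := fun e => do
      let b ← memT (e.2, e.1) E
      pure (!b)) (fun e _ => by
        have := steps_memT_le (e.2, e.1) E
        simp only [steps_bind, steps_pure]
        omega)
  have h₂ := steps_maxT_le (l := V) (k := 7 * M)
    (f := fun v => countT (fun e : α × α => do
      let b ← eqT e.1 v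
      if b then pure b else eqT e.2 v) E) (fun v _ => by
        have := steps_countT_le (l := E) (k := 2) (p := fun e : α × α => do
          let b ← eqT e.1 v
          if b then pure b else eqT e.2 v) (fun e _ => by
            simp only [steps_bind, steps_eqT, steps_ite, steps_pure]
            split_ifs <;> omega)
        omega)
  have h₃ : maxDegree V E ≤ E.length := Finset.sup_le fun v _ => List.countP_le_length
  have h₄ := steps_peelT_le (E := E.filter fun e => !decide (e.swap ∈ E)) (R := V) hM
    ((List.length_filter_le _ _).trans hE) hV (rootT (maxDegree V E) (maxDegree V E)).val hV
  have h₅ : (peelOrder V E).length ≤ V.length := length_peelT_le _ _ _ _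
  have h₆ := steps_filterT_le (l := E) (k := 4 * M)
    (p := fun e => beforeT e.1 e.2 (peelOrder V E)) (fun e _ => by
        have := steps_beforeT_le e.1 e.2 (peelOrder V E)
        omega)
  have e₁ : E.length * (3 * M + 1) ≤ M * (3 * M + 1) := Nat.mul_le_mul_right _ hE
  have e₂ : V.length * (7 * M + 2) ≤ M * (7 * M + 2) := Nat.mul_le_mul_right _ hV
  have e₃ : V.length * (121 * M ^ 4) ≤ M * (121 * M ^ 4) := Nat.mul_le_mul_right _ hV
  have e₄ : E.length * (4 * M + 1) ≤ M * (4 * M + 1) := Nat.mul_le_mul_right _ hE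
  have f₁ : M * (3 * M + 1) = 3 * M ^ 2 + M := by ring
  have f₂ : M * (7 * M + 2) = 7 * M ^ 2 + 2 * M := by ring
  have f₃ : M * (121 * M ^ 4) = 121 * M ^ 5 := by ring
  have f₄ : M * (4 * M + 1) = 4 * M ^ 2 + M := by ring
  have g₁ : M ≤ M ^ 5 := Nat.le_self_pow (by norm_num) M
  have g₂ : M ^ 2 ≤ M ^ 5 := Nat.pow_le_pow_right hM (by norm_num)
  have hsteps : (approxMAS V E).steps =
      (filterT (fun e => do
        let b ← memT (e.2, e.1) E
        pure (!b)) E).steps +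
      ((maxT (fun v => countT (fun e : α × α => do
        let b ← eqT e.1 v
        if b then pure b else eqT e.2 v) E) V).steps +
      ((4 * maxDegree V E + 1) + ((2 * V.length + 1) +
        ((peelT (E.filter fun e => !decide (e.swap ∈ E))
          (rootT (maxDegree V E) (maxDegree V E)).val V.length V).steps +
        (filterT (fun e => beforeT e.1 e.2 (peelOrder V E)) E).steps)))) := by
    simp only [approxMAS, steps_bind, val_oneWayT, val_maxT, val_degreeT, val_lengthT, steps_rootT,
      steps_lengthT]
    rfl
  rw [hsteps]
  omega

theorem isMASApprox_approxMAS (α : Type) [DecidableEq α] :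
    IsMASApprox (approxMAS (α := α)) (1 / 10) (151 * (Polynomial.X + 1) ^ 5) := by
  intro V E h
  obtain ⟨h₁, h₂⟩ := approxMAS_spec h
  refine ⟨h₁, h₂, (steps_approxMAS_le V E).trans_eq ?_⟩
  simp

end Steps

/-! ### Supersequences: topological order, reduction to arcs, ratio -/

section Supersequence

variable {α : Type} [DecidableEq α]

/-- Acyclicity provides a vertex without entering arcs in every nonempty `R`, so the recursion does
not stop early. -/
theorem topologicalT_spec {A : List (α × α)} (hA : Acyclic A) (k : ℕ) {R : List α}
    (hR : R.Nodup) (hk : R.length ≤ k) :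
    (topologicalT A k R).val.Perm R ∧ ∀ e ∈ A, e.1 ∈ R → e.2 ∈ R →
      (topologicalT A k R).val.idxOf e.1 < (topologicalT A k R).val.idxOf e.2 := by
  induction k generalizing R with
  | zero =>
    obtain rfl : R = [] := by simpa using hk
    simp [topologicalT]
  | succ k ih =>
    simp only [topologicalT, val_bind, val_findT, val_inDegT, val_pure]
    split
    · rename_i h
      rw [List.find?_eq_none] at h
      obtain rfl : R = [] := by
        by_contra hne
        obtain ⟨r, hr⟩ := List.exists_mem_of_ne_nil R hne
        -- Reachability is transitive and, by acyclicity, irreflexive, hence well-founded on the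
        -- finite set `R`. An arc entering a minimal element would contradict minimality.
        let T : {x // x ∈ R} → {x // x ∈ R} → Prop :=
          fun x y => Relation.TransGen (fun a b => (a, b) ∈ A) x.1 y.1
        have : IsTrans _ T := ⟨fun _ _ _ h h' => Relation.TransGen.trans h h'⟩
        have : Std.Irrefl T := ⟨fun x => hA x.1⟩
        obtain ⟨m, -, hm⟩ := (Finite.wellFounded_of_trans_of_irrefl T).has_min Set.univ
          ⟨⟨r, hr⟩, trivial⟩
        have hd := h m.1 m.2
        rw [decide_eq_true_eq] at hd
        obtain ⟨e, he, hp⟩ := List.countP_pos_iff.1 (Nat.pos_of_ne_zero hd)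
        rw [decide_eq_true_eq] at hp
        refine hm ⟨e.1, hp.2⟩ trivial (.single ?_)
        simpa [← hp.1] using he
      simp
    · rename_i x h
      have hx := List.mem_of_find?_eq_some h
      have hd : inDeg A R x = 0 := by simpa using List.find?_some h
      obtain ⟨ih₁, ih₂⟩ := ih (hR.filter (· ≠ x)) (by have := length_filter_ne hR hx; omega)
      simp only [val_bind, val_removeT, val_pure]
      refine ⟨(ih₁.cons x).trans (perm_cons_filter_ne hR hx), fun e he h₁ h₂ => ?_⟩
      have hne : x ≠ e.2 := by
        rintro rfl
        have := List.countP_eq_zero.1 hd e he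
        simp [h₁] at this
      by_cases h₁' : x = e.1
      · rw [← h₁', List.idxOf_cons_self, List.idxOf_cons_ne _ hne]
        omega
      · rw [List.idxOf_cons_ne _ h₁', List.idxOf_cons_ne _ hne]
        have := ih₂ e he (by simp [h₁, Ne.symm h₁']) (by simp [h₂, Ne.symm hne])
        omega

theorem length_topologicalT_le (A : List (α × α)) (k : ℕ) (R : List α) :
    (topologicalT A k R).val.length ≤ k := by
  induction k generalizing R with
  | zero => simp [topologicalT]
  | succ k ih =>
    simp only [topologicalT, val_bind]
    split
    · simp
    · rename_i x h
      simpa using ih (R.filter (· ≠ x))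

/-- The arcs that a string contributes. -/
def stringArcs (V : List α) (s : List α) : List (α × α) :=
  match s with
  | [a, b] => if a ∈ V ∧ b ∈ V then [(a, b)] else []
  | _ => []

theorem val_arcsT (V : List α) (S : List (List α)) :
    (arcsT V S).val = S.flatMap (stringArcs V) := by
  simp only [arcsT, val_flatMapT, val_bind]
  congr 1
  funext s
  rcases s with _ | ⟨a, _ | ⟨b, _ | ⟨c, s⟩⟩⟩ <;> simp [stringArcs]

theorem mem_stringArcs {V s : List α} {e : α × α} :
    e ∈ stringArcs V s ↔ s = [e.1, e.2] ∧ e.1 ∈ V ∧ e.2 ∈ V := by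
  obtain ⟨a', b'⟩ := e
  rcases s with _ | ⟨a, _ | ⟨b, _ | ⟨c, s⟩⟩⟩ <;> simp [stringArcs]
  grind

theorem mem_arcsT {V : List α} {S : List (List α)} {e : α × α} :
    e ∈ (arcsT V S).val ↔ e.1 ∈ V ∧ e.2 ∈ V ∧ [e.1, e.2] ∈ S := by
  rw [val_arcsT, List.mem_flatMap]
  simp only [mem_stringArcs]
  grind

theorem nodup_arcsT (V : List α) {S : List (List α)} (hS : S.Nodup) : (arcsT V S).val.Nodup := by
  rw [val_arcsT, List.nodup_flatMap]
  refine ⟨fun s _ => ?_, hS.imp fun {s s'} hne e he he' => ?_⟩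
  · rcases s with _ | ⟨a, _ | ⟨b, _ | ⟨c, s⟩⟩⟩ <;> simp only [stringArcs, List.nodup_nil]
    split_ifs <;> simp
  · exact hne ((mem_stringArcs.1 he).1.trans (mem_stringArcs.1 he').1.symm)

/-- The two-letter strings given by a list of arcs. -/
def arcStrings (E : List (α × α)) : List (List α) := E.map fun e => [e.1, e.2]

theorem mem_arcStrings {α : Type} {E : List (α × α)} {a b : α} :
    [a, b] ∈ arcStrings E ↔ (a, b) ∈ E := by
  simp [arcStrings]

theorem nodup_arcStrings {α : Type} {E : List (α × α)} (hE : E.Nodup) : (arcStrings E).Nodup :=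
  hE.map fun e e' h => by
    simp only [List.cons.injEq, and_true] at h
    exact Prod.ext h.1 h.2

theorem arcStrings_subperm {α : Type} {E : List (α × α)} {S : List (List α)} (hE : E.Nodup)
    (h : ∀ e ∈ E, [e.1, e.2] ∈ S) : (arcStrings E).Subperm S :=
  (nodup_arcStrings hE).subperm fun s hs => by
    obtain ⟨e, he, rfl⟩ := List.mem_map.1 hs
    exact h e he

theorem length_arcs_le {α : Type} {E : List (α × α)} {S : List (List α)} (hE : E.Nodup)
    (h : ∀ e ∈ E, [e.1, e.2] ∈ S) : E.length ≤ S.length := by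
  simpa [arcStrings] using (arcStrings_subperm hE h).length_le

theorem degree_le_count (E : List (α × α)) (v : α) :
    degree E v ≤ (arcStrings E).flatten.count v := by
  induction E with
  | nil => simp [degree]
  | cons e E ih =>
    simp only [degree, arcStrings, List.countP_cons, List.map_cons, List.flatten_cons,
      List.count_append, List.count_cons, List.count_nil] at ih ⊢
    generalize E.countP _ = m at ih ⊢
    generalize List.count v _ = n at ih ⊢
    by_cases h₁ : e.1 = v <;> by_cases h₂ : e.2 = v <;> simp [h₁, h₂] <;> omega

/-- Different arcs at `v` come from different strings of `S`, each of which contains `v`. -/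
theorem maxDegree_le_maxOccurrences (V : List α) {E : List (α × α)} {S : List (List α)}
    (hE : E.Nodup) (h : ∀ e ∈ E, [e.1, e.2] ∈ S) : maxDegree V E ≤ maxOccurrences S := by
  refine Finset.sup_le fun v _ => (degree_le_count E v).trans ?_
  have h₁ : (arcStrings E).flatten.count v ≤ S.flatten.count v := by
    obtain ⟨l, hl, hs⟩ := arcStrings_subperm hE h
    rw [← hl.flatten.count_eq]
    exact hs.flatten.count_le v
  refine h₁.trans ?_
  by_cases hv : v ∈ S.flatten
  · exact Finset.le_sup (f := fun a => S.flatten.count a) (List.mem_toFinset.2 hv)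
  · rw [List.count_eq_zero_of_not_mem hv]
    exact Nat.zero_le _

/-- The strings given by arcs form, up to order, a part of `S`, because neither list has
repetitions. -/
theorem satisfied_eq {E : List (α × α)} {S : List (List α)} (hS : S.Nodup) (hE : E.Nodup)
    (h : ∀ e ∈ E, [e.1, e.2] ∈ S) (w : List α) :
    satisfied S w = forward E w +
      (S.filter fun s => ¬ s ∈ arcStrings E).countP fun s => s.Sublist w := by
  have hp : (S.filter fun s => s ∈ arcStrings E).Perm (arcStrings E) := by
    rw [List.perm_ext_iff_of_nodup (hS.filter _) (nodup_arcStrings hE)]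
    intro s
    simp only [List.mem_filter, decide_eq_true_eq, and_iff_right_iff_imp]
    exact fun hs => (arcStrings_subperm hE h).subset hs
  have h₁ : forward E w = (S.filter fun s => s ∈ arcStrings E).countP fun s => s.Sublist w := by
    rw [hp.countP_eq, arcStrings, List.countP_map]
    rfl
  rw [h₁, List.countP_filter, List.countP_filter, satisfied]
  refine countP_eq_add fun s _ => ?_
  by_cases hs : s ∈ arcStrings E <;> simp [hs]

theorem mem_of_instance {α : Type} {l : ℕ} {S : List (List α)} {t : List α} (h : IsInstance l S t)
    {s : List α} (hs : s ∈ S) {a : α} (ha : a ∈ s) : a ∈ t := by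
  obtain ⟨-, w, hw, hsw⟩ := h.2 s hs
  exact hw.mem_iff.1 (hsw.subset ha)

/-- The restriction on instances excludes loops: the string `aa` needs two copies of `a` in `t`. -/
theorem ne_of_instance {l : ℕ} {S : List (List α)} {t : List α} (h : IsInstance l S t)
    {a b : α} (hs : [a, b] ∈ S) (ha : t.count a = 1) : a ≠ b := by
  rintro rfl
  obtain ⟨-, w, hw, hsw⟩ := h.2 _ hs
  have := hsw.sublist.count_le a
  rw [hw.count_eq, ha] at this
  simp at this

/-- The order `F · F' · F · F''` satisfies all strings but those that are given by arcs. -/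
theorem output_spec {S : List (List α)} {t V F F' F'' : List α} {E A : List (α × α)}
    (hI : IsInstance 2 S t)
    (hV : V.Nodup ∧ ∀ a, a ∈ V ↔ t.count a = 1)
    (hE : E.Nodup ∧ ∀ a b, (a, b) ∈ E ↔ a ∈ V ∧ b ∈ V ∧ [a, b] ∈ S)
    (hF : F.Nodup ∧ ∀ a, a ∈ F ↔ 2 ≤ t.count a)
    (hA : A.Nodup) (hAE : A ⊆ E) (hF' : IsTopologicalOrder V A F')
    (hF'' : ∀ a, F''.count a = t.count a - 2) :
    (F ++ F' ++ F ++ F'').Perm t ∧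
      A.length + (S.filter fun s => ¬ s ∈ arcStrings E).length ≤
        satisfied S (F ++ F' ++ F ++ F'') := by
  have hperm : (F ++ F' ++ F ++ F'').Perm t := by
    rw [List.perm_iff_count]
    intro a
    -- Multiplicity r ≥ 2 arises as 2 + (r - 2); a character of multiplicity 1 comes from `F'`, and
    -- then the truncated r - 2 is 0.
    simp only [List.count_append, hF'.1.count_eq, hF.1.count, hV.1.count, hF'', hV.2, hF.2]
    split_ifs <;> omega
  refine ⟨hperm, ?_⟩
  rw [satisfied_eq hI.1 hE.1 (fun e he => ((hE.2 e.1 e.2).1 he).2.2)]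
  have h₁ : A.length ≤ forward E (F ++ F' ++ F ++ F'') := by
    rw [forward, List.countP_eq_length_filter]
    refine (hA.subperm fun e he => ?_).length_le
    rw [List.mem_filter, decide_eq_true_eq]
    refine ⟨hAE he, ?_⟩
    have hmem : e.2 ∈ F' := hF'.1.mem_iff.2 ((hE.2 e.1 e.2).1 (hAE he)).2.1
    have := pair_sublist_of_idxOf_lt hmem (hF'.2 e he)
    rw [List.append_assoc, List.append_assoc]
    exact (this.trans (List.sublist_append_left _ _)).trans (List.sublist_append_right _ _)
  have h₂ : (S.filter fun s => ¬ s ∈ arcStrings E).countP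
      (fun s => s.Sublist (F ++ F' ++ F ++ F'')) =
      (S.filter fun s => ¬ s ∈ arcStrings E).length := by
    refine List.countP_eq_length.2 fun s hs => ?_
    simp only [List.mem_filter, decide_eq_true_eq] at hs ⊢
    obtain ⟨hsS, hsE⟩ := hs
    have hlen := (hI.2 s hsS).1
    have hmem : ∀ a ∈ s, a ∈ t := fun a ha => mem_of_instance hI hsS ha
    rcases s with _ | ⟨a, _ | ⟨b, _ | ⟨c, s⟩⟩⟩
    · exact List.nil_sublist _
    · exact List.singleton_sublist.2 (hperm.mem_iff.2 (hmem a (by simp)))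
    · have ha := List.count_pos_iff.2 (hmem a (by simp))
      have hb := List.count_pos_iff.2 (hmem b (by simp))
      rw [mem_arcStrings, hE.2, hV.2, hV.2] at hsE
      have hFF : ∀ x, 0 < t.count x → x ∈ F' ∨ x ∈ F := by
        intro x hx
        rw [hF'.1.mem_iff, hV.2, hF.2]
        omega
      -- If `a` is repeated, it is taken from the first `F` and `b` from what follows. Otherwise `b`
      -- is repeated, since `ab` is not an arc; then `a` is taken from `F'` and `b` from the second
      -- `F`.
      by_cases ha2 : 2 ≤ t.count a
      · rw [List.append_assoc, List.append_assoc]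
        refine List.Sublist.append (l₁ := [a]) (List.singleton_sublist.2 ((hF.2 a).2 ha2))
          (List.singleton_sublist.2 ?_)
        have := hFF b hb
        simp only [List.mem_append]
        tauto
      · have ha' : a ∈ F' := (hFF a ha).resolve_right fun h => ha2 ((hF.2 a).1 h)
        have hb2 : 2 ≤ t.count b := by
          by_contra hb2
          exact hsE ⟨by omega, by omega, hsS⟩
        rw [List.append_assoc]
        exact List.Sublist.append (l₁ := [a])
          (List.singleton_sublist.2 (List.mem_append_right _ ha'))
          (List.singleton_sublist.2 (List.mem_append_left _ ((hF.2 b).2 hb2)))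
    · simp at hlen
  omega

/-- With r strings that are not arcs, the output satisfies at least |A| + r strings, and a
competitor at most r plus the size of an acyclic set of arcs. -/
theorem approximation_of_isOutput {A : Subroutine α} {c : ℝ} {p : Polynomial ℕ} (hc : 0 < c)
    (hc1 : c ≤ 1) (hA : IsMASApprox A c p) {S : List (List α)} {t : List α}
    (hI : IsInstance 2 S t) {w : List α} (hw : IsOutput (fun V E => (A V E).val) S t w) :
    w.Perm t ∧ ∀ w' : List α, w'.Perm t →
      (1 + c / √(maxOccurrences S : ℝ)) / 2 * (satisfied S w' : ℝ) ≤ (satisfied S w : ℝ) := by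
  obtain ⟨V, E, F, F', F'', hV, hE, hF, hF', hF'', rfl⟩ := hw
  have hES : ∀ e ∈ E, [e.1, e.2] ∈ S := fun e he => ((hE.2 e.1 e.2).1 he).2.2
  have hdi : IsDigraph V E := ⟨hV.1, hE.1, fun e he => by
    obtain ⟨h₁, h₂, h₃⟩ := (hE.2 e.1 e.2).1 he
    exact ⟨h₁, h₂, ne_of_instance hI h₃ ((hV.2 _).1 h₁)⟩⟩
  obtain ⟨⟨hAn, hAE, hAac⟩, happ, -⟩ := hA V E hdi
  obtain ⟨hperm, hsat⟩ := output_spec hI hV hE hF hAn hAE hF' hF''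
  refine ⟨hperm, fun w' hw' => ?_⟩
  -- Vertices occur once in `w'`, so positions strictly increase along satisfied arcs.
  have hB : IsAcyclicSubgraph E (E.filter fun e => [e.1, e.2].Sublist w') := by
    refine ⟨hE.1.filter _, List.filter_subset_self _, acyclic_of_idxOf_lt w' fun e he => ?_⟩
    rw [List.mem_filter, decide_eq_true_eq] at he
    refine idxOf_lt_of_pair_sublist ?_ he.2
    rw [hw'.count_eq]
    exact ((hV.2 _).1 (hdi.2.2 e he.1).2.1).le
  have hle := happ _ hB
  rw [← List.countP_eq_length_filter] at hle
  change _ * (forward E w' : ℝ) ≤ _ at hle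
  have hrest : satisfied S w' ≤
      forward E w' + (S.filter fun s => ¬ s ∈ arcStrings E).length := by
    rw [satisfied_eq hI.1 hE.1 hES]
    exact Nat.add_le_add_left List.countP_le_length _
  generalize (S.filter fun s => ¬ s ∈ arcStrings E).length = r at hrest hsat
  have hrest' : (satisfied S w' : ℝ) ≤ forward E w' + r := by exact_mod_cast hrest
  have hsat' : ((A V E).val.length : ℝ) + r ≤ satisfied S (F ++ F' ++ F ++ F'') := by
    exact_mod_cast hsat
  -- This keeps the factor at most 1, so it can be applied to the r remaining strings as well.
  have hq1 : c / √(maxOccurrences S : ℝ) ≤ 1 := by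
    rcases Nat.eq_zero_or_pos (maxOccurrences S) with h | h
    · simp [h]
    · have : 1 ≤ √(maxOccurrences S : ℝ) := Real.one_le_sqrt.2 (by exact_mod_cast h)
      rw [div_le_one (by positivity)]
      linarith
  have hq0 : 0 ≤ c / √(maxOccurrences S : ℝ) := by positivity
  have hf : (0 : ℝ) ≤ forward E w' := by positivity
  have hr : (0 : ℝ) ≤ r := by positivity
  have harcs : (1 + c / √(maxOccurrences S : ℝ)) / 2 * (forward E w' : ℝ) ≤
      (A V E).val.length := by
    -- The factor decreases with the degree only for positive degrees, because of the value at 0; in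
    -- degree 0 there are no arcs.
    by_cases h0 : maxDegree V E = 0
    · obtain rfl := eq_nil_of_maxDegree_eq_zero (fun e he => (hdi.2.2 e he).1) h0
      simp [forward]
    · refine le_trans ?_ hle
      have hD : (0 : ℝ) < maxDegree V E := by exact_mod_cast Nat.pos_of_ne_zero h0
      have hDΔ : (maxDegree V E : ℝ) ≤ maxOccurrences S := by
        exact_mod_cast maxDegree_le_maxOccurrences V hE.1 hES
      have := Real.sqrt_pos.2 hD
      gcongr
  generalize c / √(maxOccurrences S : ℝ) = q at *
  nlinarith

theorem val_countT_eqT (a : α) (t : List α) : (countT (fun x => eqT a x) t).val = t.count a := by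
  simp only [val_countT, val_eqT, List.count]
  refine List.countP_congr fun x _ => ?_
  rw [decide_eq_true_eq, beq_iff_eq, eq_comm]

theorem count_flatMap_replicate {F : List α} (hF : F.Nodup) (k : α → ℕ) (a : α) :
    (F.flatMap fun x => List.replicate (k x) x).count a = if a ∈ F then k a else 0 := by
  induction F with
  | nil => simp
  | cons x F ih =>
    rw [List.nodup_cons] at hF
    rw [List.flatMap_cons, List.count_append, ih hF.2, List.count_replicate]
    by_cases h : x = a
    · subst h
      simp [hF.1]
    · simp [h, Ne.symm h]

theorem val_algorithm (A : Subroutine α) (S : List (List α)) (t : List α) :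
    (algorithm A S t).val =
      (t.dedup.filter fun a => 2 ≤ t.count a) ++
      ((topologicalT (A (t.filter fun a => t.count a = 1)
          (arcsT (t.filter fun a => t.count a = 1) S).val).val
        (t.filter fun a => t.count a = 1).length (t.filter fun a => t.count a = 1)).val ++
      ((t.dedup.filter fun a => 2 ≤ t.count a) ++
      (t.dedup.filter fun a => 2 ≤ t.count a).flatMap
        fun a => List.replicate (t.count a - 2) a)) := by
  simp only [algorithm, val_bind, val_filterT, val_countT_eqT, val_pure, val_dedupT, val_flatMapT,
    val_replicateT, val_lengthT, val_appendT]

theorem vertices_spec (t : List α) : (t.filter fun a => t.count a = 1).Nodup ∧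
    ∀ a, a ∈ (t.filter fun a => t.count a = 1) ↔ t.count a = 1 := by
  constructor
  · rw [List.nodup_iff_count_le_one]
    intro a
    by_cases h : t.count a = 1
    · exact (List.filter_sublist.count_le a).trans h.le
    · rw [List.count_eq_zero_of_not_mem (by simp [h])]
      exact Nat.zero_le _
  · intro a
    simp only [List.mem_filter, decide_eq_true_eq, and_iff_right_iff_imp]
    intro h
    exact List.count_pos_iff.1 (by omega)

theorem isDigraph_arcsT {l : ℕ} {S : List (List α)} {t : List α} (hI : IsInstance l S t) :
    IsDigraph (t.filter fun a => t.count a = 1)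
      (arcsT (t.filter fun a => t.count a = 1) S).val := by
  refine ⟨(vertices_spec t).1, nodup_arcsT _ hI.1, fun e he => ?_⟩
  obtain ⟨h₁, h₂, h₃⟩ := mem_arcsT.1 he
  exact ⟨h₁, h₂, ne_of_instance hI h₃ (((vertices_spec t).2 _).1 h₁)⟩

theorem isOutput_algorithm {A : Subroutine α} {c : ℝ} {p : Polynomial ℕ}
    (hA : IsMASApprox A c p) {S : List (List α)} {t : List α} (hI : IsInstance 2 S t) :
    IsOutput (fun V E => (A V E).val) S t (algorithm A S t).val := by
  obtain ⟨⟨hAn, hAE, hAac⟩, -⟩ := hA _ _ (isDigraph_arcsT hI)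
  have hV := vertices_spec t
  have hF : (t.dedup.filter fun a => 2 ≤ t.count a).Nodup ∧
      ∀ a, a ∈ (t.dedup.filter fun a => 2 ≤ t.count a) ↔ 2 ≤ t.count a := by
    refine ⟨(List.nodup_dedup t).filter _, fun a => ?_⟩
    simp only [List.mem_filter, List.mem_dedup, decide_eq_true_eq, and_iff_right_iff_imp]
    intro h
    exact List.count_pos_iff.1 (by omega)
  have htop := topologicalT_spec hAac _ hV.1 le_rfl
  refine ⟨_, _, _, _, (t.dedup.filter fun a => 2 ≤ t.count a).flatMap
      fun a => List.replicate (t.count a - 2) a, hV, ⟨nodup_arcsT _ hI.1, fun a b => mem_arcsT⟩, hF,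
    ⟨htop.1, fun e he => htop.2 e he (mem_arcsT.1 (hAE he)).1 (mem_arcsT.1 (hAE he)).2.1⟩,
    fun a => ?_, (val_algorithm A S t).trans ?_⟩
  · rw [count_flatMap_replicate hF.1 fun a => t.count a - 2]
    simp only [hF.2]
    split_ifs <;> omega
  · simp only [List.append_assoc]

/-! ### Step count of the supersequence algorithm -/

theorem steps_topologicalT_le {A : List (α × α)} {R : List α} {M : ℕ} (hM : 1 ≤ M)
    (hA : A.length ≤ M) (hR : R.length ≤ M) (k : ℕ) :
    (topologicalT A k R).steps ≤ k * (17 * M ^ 3) + 1 := by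
  induction k generalizing R with
  | zero => simp [topologicalT]
  | succ k ih =>
    have h₁ := steps_findT_le (l := R) (k := 9 * M ^ 2 + 1)
      (p := fun v => do
        let d ← inDegT A R v
        charge 1
        pure (decide (d = 0))) (fun v _ => by
          have := steps_inDegT_le hM hA hR v
          simp only [steps_bind, steps_charge, steps_pure]
          omega)
    have h₂ : R.length * (9 * M ^ 2 + 1 + 1) ≤ M * (9 * M ^ 2 + 1 + 1) := Nat.mul_le_mul_right _ hR
    have e₁ : M * (9 * M ^ 2 + 1 + 1) = 9 * M ^ 3 + 2 * M := by ring
    have e₂ : M ≤ M ^ 3 := Nat.le_self_pow (by norm_num) M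
    have e₄ : (k + 1) * (17 * M ^ 3) = k * (17 * M ^ 3) + 17 * M ^ 3 := by ring
    rw [topologicalT, steps_bind, steps_bind, steps_charge]
    split
    · simp only [steps_pure]
      omega
    · rename_i x _
      have h₃ := steps_removeT_le x R
      have h₄ := ih ((List.length_filter_le (· ≠ x) _).trans hR)
      simp only [steps_bind, steps_pure, val_removeT]
      omega

theorem steps_arcsT_le {V : List α} {S : List (List α)} {M : ℕ} (hM : 1 ≤ M)
    (hV : V.length ≤ M) (hS : S.length ≤ M) : (arcsT V S).steps ≤ 11 * M ^ 2 := by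
  have h : (arcsT V S).steps ≤ S.length * (7 * M + 1 + 2) + 1 := by
    refine steps_flatMapT_le (fun s _ => ?_) (fun s _ => ?_)
    · rcases s with _ | ⟨a, _ | ⟨b, _ | ⟨c, s⟩⟩⟩ <;>
        simp only [steps_bind, steps_charge, steps_pure, steps_ite, ite_self]
      · omega
      · omega
      · have h₁ := steps_memT_le a V
        have h₂ := steps_memT_le b V
        omega
      · omega
    · rcases s with _ | ⟨a, _ | ⟨b, _ | ⟨c, s⟩⟩⟩ <;> simp
      split_ifs <;> simp
  nlinarith

/-- Natural coefficients make evaluation monotone, so a bound in |V| + |E| becomes one in the size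
of the instance. -/
theorem eval_mono (p : Polynomial ℕ) {m n : ℕ} (h : m ≤ n) : p.eval m ≤ p.eval n := by
  rw [Polynomial.eval_eq_sum, Polynomial.eval_eq_sum]
  exact Finset.sum_le_sum fun i _ => Nat.mul_le_mul_left _ (Nat.pow_le_pow_left h i)

theorem steps_countT_eqT_le (a : α) (t : List α) :
    (countT (fun x => eqT a x) t).steps ≤ 4 * t.length + 2 := by
  have := steps_countT_le (p := fun x => eqT a x) (l := t) (k := 1) (by simp)
  omega

theorem steps_algorithm_le {A : Subroutine α} {c : ℝ} {p : Polynomial ℕ}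
    (hA : IsMASApprox A c p) {S : List (List α)} {t : List α} (hI : IsInstance 2 S t) :
    (algorithm A S t).steps ≤ 75 * (size S t + 1) ^ 4 + p.eval (size S t) := by
  obtain ⟨⟨hAn, hAE, -⟩, -, hsteps⟩ := hA _ _ (isDigraph_arcsT hI)
  have hElen : (arcsT (t.filter fun a => t.count a = 1) S).val.length ≤ S.length :=
    length_arcs_le (nodup_arcsT _ hI.1) fun e he => (mem_arcsT.1 he).2.2
  have hAlen := (hAn.subperm hAE).length_le
  have hVlen : (t.filter fun a => t.count a = 1).length ≤ t.length := List.length_filter_le _ _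
  have hCtlen : t.dedup.length ≤ t.length := (List.dedup_sublist t).length_le
  have hFlen : (t.dedup.filter fun a => 2 ≤ t.count a).length ≤ t.dedup.length :=
    List.length_filter_le _ _
  have hsz : S.length + t.length ≤ size S t := by unfold size; omega
  have hAsteps := hsteps.trans (eval_mono p (show _ ≤ size S t by omega))
  set M := size S t + 1 with hMdef
  have hM : 1 ≤ M := by omega
  simp only [algorithm, steps_bind, val_bind, val_filterT, val_countT_eqT, val_pure, val_dedupT,
    val_flatMapT, val_replicateT, val_lengthT, val_appendT, steps_appendT, steps_lengthT]
  have h₁ := steps_filterT_le (l := t) (k := 7 * M)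
    (p := fun a => do
      let k ← countT (fun x => eqT a x) t
      charge 1
      pure (decide (k = 1))) (fun a _ => by
        have := steps_countT_eqT_le a t
        simp only [steps_bind, steps_charge, steps_pure]
        omega)
  have h₂ := steps_dedupT_le t
  have h₃ := steps_filterT_le (l := t.dedup) (k := 7 * M)
    (p := fun a => do
      let k ← countT (fun x => eqT a x) t
      charge 1
      pure (decide (2 ≤ k))) (fun a _ => by
        have := steps_countT_eqT_le a t
        simp only [steps_bind, steps_charge, steps_pure]
        omega)
  have h₄ := steps_flatMapT_le (l := t.dedup.filter fun a => 2 ≤ t.count a) (k := 10 * M) (m := M)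
    (f := fun a => do
      let k ← countT (fun x => eqT a x) t
      charge 1
      replicateT a (k - 2)) (fun a _ => by
        have := steps_countT_eqT_le a t
        have h : t.count a ≤ t.length := List.count_le_length
        simp only [steps_bind, steps_charge, steps_replicateT, val_countT_eqT]
        omega) (fun a _ => by
        have h : t.count a ≤ t.length := List.count_le_length
        simp only [val_bind, val_countT_eqT, val_replicateT, List.length_replicate]
        omega)
  have h₅ := steps_arcsT_le (V := t.filter fun a => t.count a = 1) (S := S) hM (by omega) (by omega)
  have h₆ := steps_topologicalT_le (R := t.filter fun a => t.count a = 1) hM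
    (hAlen.trans (by omega)) (by omega) (t.filter fun a => t.count a = 1).length
  have h₇ := length_topologicalT_le
    (A (t.filter fun a => t.count a = 1) (arcsT (t.filter fun a => t.count a = 1) S).val).val
    (t.filter fun a => t.count a = 1).length (t.filter fun a => t.count a = 1)
  have e₁ : t.length * (7 * M + 1) ≤ M * (7 * M + 1) := Nat.mul_le_mul_right _ (by omega)
  have e₂ : t.length * (2 * t.length + 2) ≤ M * (2 * M + 2) :=
    Nat.mul_le_mul (by omega) (by omega)
  have e₃ : t.dedup.length * (7 * M + 1) ≤ M * (7 * M + 1) := Nat.mul_le_mul_right _ (by omega)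
  have e₄ : (t.dedup.filter fun a => 2 ≤ t.count a).length * (10 * M + M + 2) ≤
    M * (10 * M + M + 2) := Nat.mul_le_mul_right _ (by omega)
  have e₅ : (t.filter fun a => t.count a = 1).length * (17 * M ^ 3) ≤ M * (17 * M ^ 3) :=
    Nat.mul_le_mul_right _ (by omega)
  have f₁ : M * (7 * M + 1) = 7 * M ^ 2 + M := by ring
  have f₂ : M * (2 * M + 2) = 2 * M ^ 2 + 2 * M := by ring
  have f₃ : M * (10 * M + M + 2) = 11 * M ^ 2 + 2 * M := by ring
  have f₄ : M * (17 * M ^ 3) = 17 * M ^ 4 := by ring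
  have g₁ : M ≤ M ^ 4 := Nat.le_self_pow (by norm_num) M
  have g₂ : M ^ 2 ≤ M ^ 4 := Nat.pow_le_pow_right hM (by norm_num)
  omega

/-- The resulting polynomial depends on `p` alone, neither on `c` nor on the alphabet, so it can be
chosen before both. -/
theorem guarantee_of_isMASApprox {A : Subroutine α} {c : ℝ} {p : Polynomial ℕ} (hc : 0 < c)
    (hc1 : c ≤ 1) (hA : IsMASApprox A c p) :
    Guarantee A c (75 * (Polynomial.X + 1) ^ 4 + p) := by
  intro S t hI
  refine ⟨(steps_algorithm_le hA hI).trans_eq (by simp), isOutput_algorithm hA hI, fun w hw => ?_⟩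
  exact approximation_of_isOutput hc hc1 hA hI hw

end Supersequence

end RCS

theorem theorem11 :
    (∃ c : ℝ, 0 < c ∧ c ≤ 1 ∧ ∃ p q : Polynomial ℕ,
      ∀ (α : Type) [DecidableEq α],
        RCS.IsMASApprox (RCS.approxMAS (α := α)) c p ∧
        RCS.Guarantee (RCS.approxMAS (α := α)) c q) ∧
    (∀ p : Polynomial ℕ, ∃ q : Polynomial ℕ,
      ∀ (α : Type) [DecidableEq α] (A : RCS.Subroutine α) (c : ℝ), 0 < c → c ≤ 1 →
        RCS.IsMASApprox A c p → RCS.Guarantee A c q) := by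
  refine ⟨⟨1 / 10, by norm_num, by norm_num, _, _, fun α _ => ⟨RCS.isMASApprox_approxMAS α,
    RCS.guarantee_of_isMASApprox (by norm_num) (by norm_num) (RCS.isMASApprox_approxMAS α)⟩⟩,
    fun p => ⟨_, fun α _ A c hc hc1 hA => RCS.guarantee_of_isMASApprox hc hc1 hA⟩⟩
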